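/- Let $M$ be a connected smooth manifold with smooth (possibly empty) boundary $\partial M$, equipped with a smooth measure $\mu$ (in local coordinates, a smooth positive density times Lebesgue measure). Let $(E,h^E),(F,h^F)\to M$ be smooth Hermitian vector bundles and let $D\colon C^\infty(M;E)\to C^\infty(M;F)$ be a first-order linear differential operator. Let $\sigma_D(x,\xi)\colon E_x\to F_x$ be its principal symbol, i.e. $\sigma_D(x,\xi)u(x)=\big(D(fu)-fDu\big)(x)$ whenever $f\in C^\infty(M,\mathbb R)$ satisfies $df(x)=\xi$ and $u\in C^\infty(M;E)$. Let $D^\dagger\colon C^\infty(M;F)\to C^\infty(M;E)$ be the formal adjoint of $D$, i.e. the unique linear operator with $\langle Du,v\rangle_{L^2(M;F)}=\langle u,D^\dagger v\rangle_{L^2(M;E)}$ for all $v\in C^\infty(M;F)$ and all $u\in C^\infty_{cc}(M;E)$, where $C^\infty_{cc}$ denotes the smooth sections whose support is compact and contained in the interior of $M$. Let $D_{\max}=(D^\dagger)^{*}$ be the Hilbert space adjoint of $D^\dagger$ restricted to $C^\infty_{cc}(M;F)$, as an unbounded operator from $L^2(M;F)$ to $L^2(M;E)$, and let $(D^\dagger)_{\max}=D^{*}$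 be the Hilbert space adjoint of $D$ restricted to $C^\infty_{cc}(M;E)$. Suppose that $M$ carries a complete Riemannian metric (not necessarily related to $\mu$) with distance function $\mathrm{dist}$, a point $p\in M$ and a positive, monotonically increasing (not necessarily strictly), continuous function $C\colon[0,\infty)\to\mathbb R$ with $$\int_0^\infty\frac{dr}{C(r)}=\infty$$ such that the operator norm of the principal symbol satisfies $$|\sigma_D(x,\xi)|\le C(\mathrm{dist}(x,p))\,|\xi|\qquad\text{for all }x\in M,\ \xi\in T_x^*M .$$ Then $D$ and $D^\dagger$ are complete: the elements of $\mathrm{dom}(D_{\max})$ with compact support in $M$ (the support may meet $\partial M$) are dense in $\mathrm{dom}(D_{\max})$ for the graph norm $(\|u\|_{L^2}^2+\|D_{\max}u\|_{L^2}^2)^{1/2}$, and likewise the compactly supported elements of $\mathrm{dom}((D^\dagger)_{\max})$ are dense in $\mathrm{dom}((D^\dagger)_{\max})$ for its graph norm. -/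

import Mathlib

open Bundle Manifold MeasureTheory Set
open scoped ContDiff ENNReal Topology

noncomputable section

namespace FirstOrderCompleteness

/-! ### Smooth measures -/

section Measures

variable {n : ℕ} {H : Type*} [TopologicalSpace H]
  (I : ModelWithCorners ℝ (EuclideanSpace ℝ (Fin n)) H)
  {M : Type*} [TopologicalSpace M] [ChartedSpace H M] [MeasurableSpace M]

/-- A measure is smooth if in local coordinates around every point it has a smooth, everywhere
positive density with respect to Lebesgue measure. -/
def IsSmoothMeasure (μ : Measure M) : Prop :=
  ∀ x₀ : M, ∃ ρ : EuclideanSpace ℝ (Fin n) → ℝ,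
    ContDiffOn ℝ ∞ ρ (extChartAt I x₀).target ∧
    (∀ y ∈ (extChartAt I x₀).target, 0 < ρ y) ∧
    ∀ s ⊆ (extChartAt I x₀).source, MeasurableSet s →
      μ s = ∫⁻ y in extChartAt I x₀ '' s, ENNReal.ofReal (ρ y)

end Measures

/-! ### Smooth sections of complex vector bundles -/

section Sections

variable {n : ℕ} {H : Type*} [TopologicalSpace H]
  (I : ModelWithCorners ℝ (EuclideanSpace ℝ (Fin n)) H)
  {M : Type*} [TopologicalSpace M] [ChartedSpace H M]
  (E₀ : Type*) [NormedAddCommGroup E₀] [NormedSpace ℂ E₀]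
  (E : M → Type*) [TopologicalSpace (TotalSpace E₀ E)]
  [∀ x, NormedAddCommGroup (E x)] [∀ x, InnerProductSpace ℂ (E x)]
  [FiberBundle E₀ E] [VectorBundle ℂ E₀ E] [VectorBundle ℝ E₀ E]

/-- The complex vector space `C^∞(M; E)` of smooth sections of `E` (smooth up to the boundary). -/
def SmoothSections : Submodule ℂ (∀ x, E x) where
  carrier := {u | ContMDiff I (I.prod 𝓘(ℝ, E₀)) ∞ (fun x => TotalSpace.mk' E₀ x (u x))}
  add_mem' hu hv := ContMDiff.add_section hu hv
  zero_mem' := contMDiff_zeroSection ℝ E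
  smul_mem' c u hu := by
    intro x₀
    have h := hu x₀
    rw [contMDiffAt_section] at h ⊢
    refine ((ContinuousLinearMap.contMDiff (c • ContinuousLinearMap.id ℝ E₀)).contMDiffAt.comp
      x₀ h).congr_of_eventuallyEq ?_
    filter_upwards [(trivializationAt E₀ E x₀).open_baseSet.mem_nhds
      (mem_baseSet_trivializationAt E₀ E x₀)] with x hx
    exact ((trivializationAt E₀ E x₀).linear ℂ hx).2 c (u x)


variable {I E₀ E}

/-- The product `f u` of a smooth real function and a smooth section. -/
def mulFun (f : C^∞⟮I, M; ℝ⟯) (u : SmoothSections I E₀ E) :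
    SmoothSections I E₀ E :=
  ⟨fun x => f x • u.1 x, ContMDiff.smul_section f.contMDiff u.2⟩

/-- The section written in the preferred trivialization around `x₀`, as a function with values in
the model fibre. It is meaningful on the base set of that trivialization. -/
def localRep (E₀ : Type*) [NormedAddCommGroup E₀] [NormedSpace ℂ E₀]
    {E : M → Type*} [TopologicalSpace (TotalSpace E₀ E)]
    [∀ x, NormedAddCommGroup (E x)] [FiberBundle E₀ E]
    (x₀ : M) (u : ∀ x, E x) : M → E₀ :=
  fun x => (trivializationAt E₀ E x₀ (TotalSpace.mk' E₀ x (u x))).2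

/-- The section `u` vanishes at `x` together with its first derivatives. -/
def OneJetVanishesAt (u : SmoothSections I E₀ E) (x : M) : Prop :=
  u.1 x = 0 ∧ mfderiv I 𝓘(ℝ, E₀) (localRep E₀ x u.1) x = 0

/-- Compact support contained in the interior of the manifold. -/
def IsCC (u : SmoothSections I E₀ E) : Prop :=
  ∃ K : Set M, IsCompact K ∧ K ⊆ I.interior M ∧ ∀ x ∉ K, u.1 x = 0

variable (I E₀ E) in
/-- The fibrewise Hermitian inner products depend smoothly on the base point: together with the
inner product space structures on the fibres this makes `E` a Hermitian vector bundle. -/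
def IsSmoothHermitian : Prop :=
  ∀ u v : SmoothSections I E₀ E,
    ContMDiff I 𝓘(ℝ, ℂ) ∞ (fun x => inner ℂ (u.1 x) (v.1 x))

lemma contMDiffAt_localRep (u : SmoothSections I E₀ E) (x : M) :
    ContMDiffAt I 𝓘(ℝ, E₀) ∞ (localRep E₀ x u.1) x :=
  (contMDiffAt_section x).1 (u.2 x)

set_option linter.unusedSectionVars false in
lemma localRep_self_eq_zero_iff (u : ∀ x, E x) (x : M) : localRep E₀ x u x = 0 ↔ u x = 0 := by
  have hx := mem_baseSet_trivializationAt E₀ E x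
  have h : localRep E₀ x u x =
      ((trivializationAt E₀ E x).continuousLinearEquivAt ℂ x hx) (u x) := by
    simp [localRep, Trivialization.continuousLinearEquivAt_apply]
  rw [h]
  exact map_eq_zero_iff _ (ContinuousLinearEquiv.injective _)

lemma hasMFDerivAt_smul_of_eq_zero {f : M → ℝ} {g : M → E₀} {x : M}
    {f' : TangentSpace I x →L[ℝ] ℝ} {g' : TangentSpace I x →L[ℝ] E₀}
    (hf : HasMFDerivAt I 𝓘(ℝ, ℝ) f x f') (hg : HasMFDerivAt I 𝓘(ℝ, E₀) g x g')
    (h₀ : f x = 0) (h : f' = 0 ∨ g x = 0) :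
    HasMFDerivAt I 𝓘(ℝ, E₀) (fun y => f y • g y) x (0 : TangentSpace I x →L[ℝ] E₀) := by
  refine ⟨hf.1.smul hg.1, ?_⟩
  have h2 := hf.2.smul hg.2
  refine h2.congr_fderiv ?_
  have hf₀ : writtenInExtChartAt I 𝓘(ℝ, ℝ) x f (extChartAt I x x) = 0 := by
    change f ((extChartAt I x).symm (extChartAt I x x)) = 0
    rw [extChartAt_to_inv, h₀]
  have hg₀ : writtenInExtChartAt I 𝓘(ℝ, E₀) x g (extChartAt I x x) = g x := by
    change g ((extChartAt I x).symm (extChartAt I x x)) = g x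
    rw [extChartAt_to_inv]
  rw [hf₀, hg₀]
  rcases h with h | h
  · subst h
    ext v
    exact (congrArg₂ (· + ·) (zero_smul ℝ _) (zero_smul ℝ _)).trans (add_zero _)
  · rw [h]
    ext v
    exact (congrArg₂ (· + ·) (zero_smul ℝ _) (smul_zero _)).trans (add_zero _)

lemma oneJetVanishesAt_mulFun {f : C^∞⟮I, M; ℝ⟯} {u : SmoothSections I E₀ E} {x : M}
    (hf : f x = 0) (h : mfderiv I 𝓘(ℝ, ℝ) f x = 0 ∨ u.1 x = 0) :
    OneJetVanishesAt (mulFun f u) x := by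
  refine ⟨by simp [mulFun, hf], ?_⟩
  have hev : localRep E₀ x (mulFun f u).1 =ᶠ[𝓝 x]
      fun y => f y • localRep E₀ x u.1 y := by
    filter_upwards [(trivializationAt E₀ E x).open_baseSet.mem_nhds
      (mem_baseSet_trivializationAt E₀ E x)] with y hy
    exact ((trivializationAt E₀ E x).linear ℝ hy).2 (f y) (u.1 y)
  rw [hev.mfderiv_eq]
  have hfd : HasMFDerivAt I 𝓘(ℝ, ℝ) f x (mfderiv I 𝓘(ℝ, ℝ) f x) :=
    (f.contMDiff.mdifferentiableAt (by simp)).hasMFDerivAt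
  have hud := ((contMDiffAt_localRep u x).mdifferentiableAt (by simp)).hasMFDerivAt
  exact (hasMFDerivAt_smul_of_eq_zero hfd hud hf
    (h.imp_right (localRep_self_eq_zero_iff u.1 x).2)).mfderiv

/-- There is a smooth function with prescribed differential at a point. -/
lemma exists_mfderiv_eq [T2Space M] [IsManifold I ∞ M] (x : M) (ξ : TangentSpace I x →L[ℝ] ℝ) :
    ∃ f : C^∞⟮I, M; ℝ⟯, (mfderiv I 𝓘(ℝ, ℝ) f x : TangentSpace I x →L[ℝ] ℝ) = ξ := by
  let ξ' : EuclideanSpace ℝ (Fin n) →L[ℝ] ℝ := ξ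
  obtain ⟨b⟩ : Nonempty (SmoothBumpFunction I x) := inferInstance
  have hg : ContMDiffOn I 𝓘(ℝ, ℝ) ∞ (fun y => ξ' (extChartAt I x y)) (chartAt H x).source :=
    ξ'.contMDiff.comp_contMDiffOn contMDiffOn_extChartAt
  refine ⟨⟨fun y => b y • ξ' (extChartAt I x y), b.contMDiff_smul hg⟩, ?_⟩
  have hev : (fun y => b y • ξ' (extChartAt I x y)) =ᶠ[𝓝 x] fun y => ξ' (extChartAt I x y) := by
    filter_upwards [b.eventuallyEq_one] with y hy
    simp [hy]
  have h1 := hasMFDerivAt_extChartAt (I := I) (mem_chart_source H x)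
  have h0 : HasMFDerivAt 𝓘(ℝ, EuclideanSpace ℝ (Fin n)) 𝓘(ℝ, ℝ) ξ' (extChartAt I x x) ξ' :=
    ξ'.hasFDerivAt.hasMFDerivAt
  refine Eq.trans ((h0.comp x h1).congr_of_eventuallyEq hev).mfderiv ?_
  refine ContinuousLinearMap.ext fun v => ?_
  have h4 : mfderiv I I (chartAt H x) x = tangentCoordChange I x x x :=
    mfderiv_chartAt_eq_tangentCoordChange (mem_chart_source H x)
  have h5 : tangentCoordChange I x x x v = v := tangentCoordChange_self (mem_extChartAt_source x)
  exact congrArg ξ' ((DFunLike.congr_fun h4 v).trans h5)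

/-- There is a smooth section with prescribed value at a point. -/
lemma exists_section_eq [T2Space M] [IsManifold I ∞ M] [ContMDiffVectorBundle ∞ E₀ E I]
    (x : M) (e : E x) : ∃ u : SmoothSections I E₀ E, u.1 x = e := by
  obtain ⟨s, hs, hsm⟩ := FiberBundle.exists_contMDiffOn_extend (𝕜 := ℝ) (k := ∞) I E₀ e
  obtain ⟨b, -, hb⟩ := (SmoothBumpFunction.nhds_basis_tsupport (I := I) x).mem_iff.1
    (interior_mem_nhds.2 hs)
  refine ⟨⟨_, ContMDiffOn.smul_section_of_tsupport (b.contMDiff.contMDiffOn) isOpen_interior hb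
    (hsm.mono interior_subset)⟩, ?_⟩
  simp

end Sections

/-! ### First-order differential operators, symbols, formal adjoints, extensions in `L²` -/

section Operators

variable {n : ℕ} {H : Type*} [TopologicalSpace H]
  {I : ModelWithCorners ℝ (EuclideanSpace ℝ (Fin n)) H}
  {M : Type*} [TopologicalSpace M] [ChartedSpace H M]
  {E₀ : Type*} [NormedAddCommGroup E₀] [NormedSpace ℂ E₀]
  {E : M → Type*} [TopologicalSpace (TotalSpace E₀ E)]
  [∀ x, NormedAddCommGroup (E x)] [∀ x, InnerProductSpace ℂ (E x)]
  [FiberBundle E₀ E] [VectorBundle ℂ E₀ E] [VectorBundle ℝ E₀ E]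
  {F₀ : Type*} [NormedAddCommGroup F₀] [NormedSpace ℂ F₀]
  {F : M → Type*} [TopologicalSpace (TotalSpace F₀ F)]
  [∀ x, NormedAddCommGroup (F x)] [∀ x, InnerProductSpace ℂ (F x)]
  [FiberBundle F₀ F] [VectorBundle ℂ F₀ F] [VectorBundle ℝ F₀ F]

/-- A linear operator `D : C^∞(M; E) → C^∞(M; F)` is a first-order differential operator if
`(D u)(x)` only depends on the one-jet of `u` at `x`. Equivalently, in local coordinates and
trivializations, `D = ∑ⱼ Aⱼ ∂ⱼ + B` with matrix-valued functions `Aⱼ`, `B`, which are automatically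
smooth because `D` maps smooth sections to smooth sections. -/
def IsFirstOrder (D : SmoothSections I E₀ E →ₗ[ℂ] SmoothSections I F₀ F) : Prop :=
  ∀ (u : SmoothSections I E₀ E) (x : M), OneJetVanishesAt u x → (D u).1 x = 0

/-- The commutator `[D, f]` applied to `u`, at the point `x`. -/
def commutatorAt (D : SmoothSections I E₀ E →ₗ[ℂ] SmoothSections I F₀ F) (f : C^∞⟮I, M; ℝ⟯)
    (u : SmoothSections I E₀ E) (x : M) : F x :=
  (D (mulFun f u)).1 x - f x • (D u).1 x

/-- The principal symbol `σ_D(x, ξ) : E_x → F_x` of a first-order operator: `σ_D(x, ξ) e` is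
`[D, f] u (x)` for any smooth function `f` with `df(x) = ξ` and any smooth section `u` with
`u(x) = e`. By `principalSymbol_apply` the choices of `f` and `u` do not matter. -/
def principalSymbol [T2Space M] [IsManifold I ∞ M] [ContMDiffVectorBundle ∞ E₀ E I]
    (D : SmoothSections I E₀ E →ₗ[ℂ] SmoothSections I F₀ F) (x : M)
    (ξ : TangentSpace I x →L[ℝ] ℝ) (e : E x) : F x :=
  commutatorAt D (exists_mfderiv_eq x ξ).choose
    (exists_section_eq (I := I) (E₀ := E₀) x e).choose x

/-- `[D, f] u (x)` only depends on `df(x)` and `u(x)`. -/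
lemma commutatorAt_congr {D : SmoothSections I E₀ E →ₗ[ℂ] SmoothSections I F₀ F}
    (hD : IsFirstOrder D) {f g : C^∞⟮I, M; ℝ⟯} {u v : SmoothSections I E₀ E} {x : M}
    (hfg : mfderiv I 𝓘(ℝ, ℝ) f x = mfderiv I 𝓘(ℝ, ℝ) g x) (huv : u.1 x = v.1 x) :
    commutatorAt D f u x = commutatorAt D g v x := by
  let s : C^∞⟮I, M; ℝ⟯ → C^∞⟮I, M; ℝ⟯ := fun h =>
    ⟨fun y => h y - h x, h.contMDiff.sub contMDiff_const⟩
  have key : ∀ (h : C^∞⟮I, M; ℝ⟯) (w : SmoothSections I E₀ E),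
      commutatorAt D h w x = (D (mulFun (s h) w)).1 x := by
    intro h w
    have h1 : mulFun (s h) w = mulFun h w - ((h x : ℝ) : ℂ) • w := by
      ext y
      exact (sub_smul (h y) (h x) (w.1 y)).trans (by simp [mulFun])
    rw [h1, map_sub, map_smul]
    simp [commutatorAt]
  have h1 : commutatorAt D f u x = commutatorAt D f v x := by
    rw [key, key, ← sub_eq_zero]
    have h3 : mulFun (s f) u - mulFun (s f) v = mulFun (s f) (u - v) := by
      ext y
      exact (smul_sub (s f y) (u.1 y) (v.1 y)).symm
    have h2 := hD _ x (oneJetVanishesAt_mulFun (f := s f) (u := u - v) (x := x)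
      (sub_self (f x)) (Or.inr (by simp [huv])))
    rw [← h3, map_sub] at h2
    exact h2
  have h2 : commutatorAt D f v x = commutatorAt D g v x := by
    rw [key, key, ← sub_eq_zero]
    let d : C^∞⟮I, M; ℝ⟯ :=
      ⟨fun y => (f y - f x) - (g y - g x),
        (f.contMDiff.sub contMDiff_const).sub (g.contMDiff.sub contMDiff_const)⟩
    have h3 : mulFun (s f) v - mulFun (s g) v = mulFun d v := by
      ext y
      exact (sub_smul (s f y) (s g y) (v.1 y)).symm
    have hf := (f.contMDiff.mdifferentiableAt (x := x) (by simp)).hasMFDerivAt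
    have hg := (g.contMDiff.mdifferentiableAt (x := x) (by simp)).hasMFDerivAt
    rw [← hfg] at hg
    have hd : HasMFDerivAt I 𝓘(ℝ, ℝ) d x (0 : TangentSpace I x →L[ℝ] ℝ) :=
      ⟨d.contMDiff.continuous.continuousAt,
        ((hf.2.sub_const (f x)).sub (hg.2.sub_const (g x))).congr_fderiv (sub_self _)⟩
    have h4 := hD _ x (oneJetVanishesAt_mulFun (f := d) (u := v) (x := x)
      (show (f x - f x) - (g x - g x) = 0 by simp) (Or.inl hd.mfderiv))
    rw [← h3, map_sub] at h4
    exact h4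
  exact h1.trans h2

theorem principalSymbol_apply [T2Space M] [IsManifold I ∞ M] [ContMDiffVectorBundle ∞ E₀ E I]
    {D : SmoothSections I E₀ E →ₗ[ℂ] SmoothSections I F₀ F} (hD : IsFirstOrder D)
    (f : C^∞⟮I, M; ℝ⟯) (u : SmoothSections I E₀ E) (x : M) :
    principalSymbol D x (mfderiv I 𝓘(ℝ, ℝ) f x) (u.1 x) = commutatorAt D f u x := by
  exact commutatorAt_congr hD (exists_mfderiv_eq (I := I) x (mfderiv I 𝓘(ℝ, ℝ) f x)).choose_spec
    (exists_section_eq (I := I) (E₀ := E₀) x (u.1 x)).choose_spec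

variable [MeasurableSpace M]

/-- `D†` is the formal adjoint of `D`: it is an operator `C^∞(M; F) → C^∞(M; E)` with
`⟨D u, v⟩ = ⟨u, D† v⟩` in `L²` for all smooth `u`, `v` such that the support of `u` is compact and
contained in the interior of `M`. Such an operator is unique. -/
def IsFormalAdjoint (μ : Measure M) (D : SmoothSections I E₀ E →ₗ[ℂ] SmoothSections I F₀ F)
    (Ddag : SmoothSections I F₀ F →ₗ[ℂ] SmoothSections I E₀ E) : Prop :=
  ∀ (u : SmoothSections I E₀ E) (v : SmoothSections I F₀ F), IsCC u →
    ∫ x, inner ℂ ((D u).1 x) (v.1 x) ∂μ = ∫ x, inner ℂ (u.1 x) ((Ddag v).1 x) ∂μ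

/-- Measurability of a (not necessarily continuous) section, up to null sets: measurability in
the local trivializations. -/
def AEMeasurableSection (E₀ : Type*) [NormedAddCommGroup E₀] [NormedSpace ℂ E₀]
    {E : M → Type*} [TopologicalSpace (TotalSpace E₀ E)]
    [∀ x, NormedAddCommGroup (E x)] [FiberBundle E₀ E]
    (μ : Measure M) (u : ∀ x, E x) : Prop :=
  ∀ x₀ : M, AEStronglyMeasurable (localRep E₀ x₀ u)
    (μ.restrict (trivializationAt E₀ E x₀).baseSet)

/-- The `L²` norm of a section, possibly infinite. -/
def l2Norm {E : M → Type*} [∀ x, NormedAddCommGroup (E x)] (μ : Measure M) (u : ∀ x, E x) :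
    ℝ≥0∞ :=
  (∫⁻ x, ‖u x‖ₑ ^ 2 ∂μ) ^ (1 / 2 : ℝ)

/-- `u` represents an element of `L²(M; E)`. -/
def MemL2 (E₀ : Type*) [NormedAddCommGroup E₀] [NormedSpace ℂ E₀]
    {E : M → Type*} [TopologicalSpace (TotalSpace E₀ E)]
    [∀ x, NormedAddCommGroup (E x)] [FiberBundle E₀ E]
    (μ : Measure M) (u : ∀ x, E x) : Prop :=
  AEMeasurableSection E₀ μ u ∧ l2Norm μ u < ⊤

/-- Let `T_cc` be the restriction of `T : C^∞(M; F) → C^∞(M; E)` to the smooth sections with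
compact support in the interior, an unbounded operator `L²(M; F) → L²(M; E)`. This is the graph of
its Hilbert space adjoint `(T_cc)* : L²(M; E) → L²(M; F)`: it contains `(u, w)` if
`u` is in the domain of `(T_cc)*` and `(T_cc)* u = w`. Elements of `L²` are represented by sections,
and equality is equality almost everywhere. -/
def adjointGraph (μ : Measure M) (T : SmoothSections I F₀ F →ₗ[ℂ] SmoothSections I E₀ E) :
    Set ((∀ x, E x) × (∀ x, F x)) :=
  {q | MemL2 E₀ μ q.1 ∧ MemL2 F₀ μ q.2 ∧
    ∀ φ : SmoothSections I F₀ F, IsCC φ →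
      ∫ x, inner ℂ ((T φ).1 x) (q.1 x) ∂μ = ∫ x, inner ℂ (φ.1 x) (q.2 x) ∂μ}

/-- The graph of the maximal extension `D_max = (D†)*` of the operator `D` with formal adjoint
`D†`, as a set of pairs `(u, D_max u)`. -/
def maxGraph (μ : Measure M) (Ddag : SmoothSections I F₀ F →ₗ[ℂ] SmoothSections I E₀ E) :
    Set ((∀ x, E x) × (∀ x, F x)) :=
  adjointGraph μ Ddag

/-- The graph norm `(‖u‖² + ‖w‖²)^{1/2}` of a pair `(u, w)` of sections. -/
def graphNorm {E F : M → Type*} [∀ x, NormedAddCommGroup (E x)] [∀ x, NormedAddCommGroup (F x)]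
    (μ : Measure M) (q : (∀ x, E x) × (∀ x, F x)) : ℝ≥0∞ :=
  (l2Norm μ q.1 ^ 2 + l2Norm μ q.2 ^ 2) ^ (1 / 2 : ℝ)

/-- An operator given by its graph is complete if the compactly supported elements of its domain
are dense in its domain for the graph norm. The supports are compact subsets of `M`, which may
meet the boundary. -/
def IsComplete {E F : M → Type*} [∀ x, NormedAddCommGroup (E x)]
    [∀ x, NormedAddCommGroup (F x)] (μ : Measure M) (G : Set ((∀ x, E x) × (∀ x, F x))) : Prop :=
  ∀ q ∈ G, ∀ ε : ℝ, 0 < ε → ∃ q' ∈ G,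
    (∃ K : Set M, IsCompact K ∧ ∀ x ∉ K, q'.1 x = 0) ∧
    graphNorm μ (q - q') < ENNReal.ofReal ε

end Operators

end FirstOrderCompleteness

end

/-! Completeness follows from cutting off. For `u` in the domain of `D_max` and a compactly
supported smooth `χ` with bounded `σ_D(dχ)`, the product rule `D_max (χ u) = χ D_max u + σ_D(dχ) u`
holds (`smul_mem_adjointGraph`). With cutoffs `χ_k` equal to `1` off sets `S k` that shrink to the
empty set, the graph-norm error is controlled by the parts of `u` and `D_max u` on `S k` and by `sup
|σ_D(dχ_k)| ‖u‖`. It therefore suffices that the symbol at `dχ_k` tends to zero uniformly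
(`isComplete_of_isCutoffSequence`). The product rule is only tested against sections supported in
the interior, so no boundary term arises.

The same cutoffs serve `D†`, because `[D†, f] = -[D, f]*` fibrewise
(`IsFormalAdjoint.inner_commutatorAt_add`). This comes from integrating against test functions in
the interior, and extends to the boundary by continuity and density.

The cutoffs (`exists_isCutoffSequence`) are `χ_k = θ(h(f₀ + 1) / (k + 1))`. Here `f₀` is a smooth
function within `1` of `dist(·, p)` with differential at most `5`, `h` is smooth with `|h'| ≤ 1/C`
and `h → ∞`, which is possible because `∫ 1/C = ∞`, and `θ` is a smooth step from `1` to `0`. Then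
`C(dist(·, p)) |dχ_k|` is `O(1/k)`, while the supports are compact because closed balls in a
complete Riemannian manifold are compact (Hopf–Rinow). The function `f₀` is made by mollifying in
charts and gluing with a partition of unity (`exists_smooth_approx_of_lipschitzWith`). -/

noncomputable section

namespace FirstOrderCompleteness

/-! ### Consequences of smoothness of a measure -/

section SmoothMeasure

variable {n : ℕ} {H : Type*} [TopologicalSpace H]
  {I : ModelWithCorners ℝ (EuclideanSpace ℝ (Fin n)) H}
  {M : Type*} [TopologicalSpace M] [ChartedSpace H M]

lemma extChartAt_image_eq (x₀ : M) (s : Set M) :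
    extChartAt I x₀ '' s = I.symm ⁻¹' (chartAt H x₀ '' s) ∩ range I := by
  rw [← I.image_eq, ← image_comp, extChartAt_coe]

lemma measurableSet_extChartAt_image {x₀ : M} {s : Set M} (hs : IsOpen s)
    (hsub : s ⊆ (chartAt H x₀).source) : MeasurableSet (extChartAt I x₀ '' s) := by
  rw [extChartAt_image_eq]
  exact (((chartAt H x₀).isOpen_image_of_subset_source hs hsub).preimage
    I.continuous_symm).measurableSet.inter I.isClosed_range.measurableSet

/-- This includes boundary points: the range of `I` lies in the closure of its interior, so the open
set that cuts out the chart image meets that interior. -/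
lemma interior_extChartAt_image_nonempty {x₀ : M} {s : Set M} (hs : IsOpen s)
    (hsub : s ⊆ (chartAt H x₀).source) (hx₀ : x₀ ∈ s) :
    (interior (extChartAt I x₀ '' s)).Nonempty := by
  have hO : IsOpen (I.symm ⁻¹' (chartAt H x₀ '' s)) :=
    ((chartAt H x₀).isOpen_image_of_subset_source hs hsub).preimage I.continuous_symm
  have hmem : I (chartAt H x₀ x₀) ∈ closure (interior (range I)) :=
    I.range_subset_closure_interior (mem_range_self _)
  obtain ⟨y, hy, hy'⟩ := mem_closure_iff.1 hmem _ hO (by simpa using mem_image_of_mem _ hx₀)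
  rw [extChartAt_image_eq, interior_inter, hO.interior_eq]
  exact ⟨y, hy, hy'⟩

/-- The interior of a smooth manifold is dense. -/
lemma dense_interior [IsManifold I ∞ M] : Dense (I.interior M) := by
  have : IsManifold I 1 M := IsManifold.of_le (n := ∞) (by simp)
  rw [dense_iff_inter_open]
  rintro U hU ⟨x₀, hx₀⟩
  obtain ⟨y, hy⟩ := interior_extChartAt_image_nonempty (I := I)
    (hU.inter (chartAt H x₀).open_source) inter_subset_right ⟨hx₀, mem_chart_source H x₀⟩
  obtain ⟨x, hx, rfl⟩ := interior_subset hy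
  refine ⟨x, hx.1, ?_⟩
  -- Being an interior point may be tested in any chart of the atlas, here the one around `x₀`.
  refine (I.isInteriorPoint_iff_of_mem_atlas one_ne_zero (chart_mem_atlas H x₀) hx.2).2 ?_
  refine interior_mono ?_ hy
  rintro _ ⟨z, hz, rfl⟩
  exact (extChartAt I x₀).map_source (by simpa using hz.2)

variable [MeasurableSpace M] [BorelSpace M] {μ : Measure M}

/-- Near the centre of a chart the density is bounded by continuity, and the chart image can be kept
inside a unit ball. -/
lemma IsSmoothMeasure.isLocallyFiniteMeasure (hμ : IsSmoothMeasure I μ) :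
    IsLocallyFiniteMeasure μ := by
  refine ⟨fun x₀ => ?_⟩
  obtain ⟨ρ, hρ, -, h⟩ := hμ x₀
  set y₀ := extChartAt I x₀ x₀
  have hc := hρ.continuousOn y₀ (mem_extChartAt_target x₀)
  obtain ⟨O, hO, hyO, hsub⟩ := mem_nhdsWithin.1
    (hc (Iio_mem_nhds (lt_add_one (ρ y₀))))
  let s := (extChartAt I x₀).source ∩ extChartAt I x₀ ⁻¹' (O ∩ Metric.ball y₀ 1)
  have hs : IsOpen s := isOpen_extChartAt_preimage' x₀ (hO.inter Metric.isOpen_ball)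
  refine ⟨s, hs.mem_nhds ⟨mem_extChartAt_source x₀, hyO, Metric.mem_ball_self one_pos⟩, ?_⟩
  rw [h s inter_subset_left hs.measurableSet]
  have hA : MeasurableSet (extChartAt I x₀ '' s) :=
    measurableSet_extChartAt_image hs (by simp [s])
  calc ∫⁻ y in extChartAt I x₀ '' s, ENNReal.ofReal (ρ y)
      ≤ ∫⁻ _ in extChartAt I x₀ '' s, ENNReal.ofReal (ρ y₀ + 1) := by
        refine setLIntegral_mono' hA fun y hy => ?_
        obtain ⟨x, hx, rfl⟩ := hy
        exact ENNReal.ofReal_le_ofReal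
          (le_of_lt (hsub ⟨hx.2.1, (extChartAt I x₀).map_source hx.1⟩))
    _ ≤ ENNReal.ofReal (ρ y₀ + 1) * volume (Metric.ball y₀ 1) := by
        rw [setLIntegral_const]
        gcongr
        rintro _ ⟨x, hx, rfl⟩
        exact hx.2.2
    _ < ⊤ := ENNReal.mul_lt_top ENNReal.ofReal_lt_top measure_ball_lt_top

/-- Since the density is positive, a null neighbourhood would have a Lebesgue-null chart image, but
that image has interior points. -/
lemma IsSmoothMeasure.isOpenPosMeasure (hμ : IsSmoothMeasure I μ) : μ.IsOpenPosMeasure := by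
  refine ⟨fun U hU ⟨x₀, hx₀⟩ h0 => ?_⟩
  obtain ⟨ρ, hρ, hpos, h⟩ := hμ x₀
  let s := U ∩ (chartAt H x₀).source
  have hs : IsOpen s := hU.inter (chartAt H x₀).open_source
  have hsub : s ⊆ (extChartAt I x₀).source := by simp [s]
  have hsub' : extChartAt I x₀ '' s ⊆ (extChartAt I x₀).target := by
    rintro _ ⟨x, hx, rfl⟩
    exact (extChartAt I x₀).map_source (hsub hx)
  have hA : MeasurableSet (extChartAt I x₀ '' s) :=
    measurableSet_extChartAt_image hs inter_subset_right
  have hs0 : μ s = 0 := measure_mono_null inter_subset_left h0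
  rw [h s hsub hs.measurableSet, lintegral_eq_zero_iff'
    ((hρ.continuousOn.mono hsub').aemeasurable hA).ennreal_ofReal,
    Filter.EventuallyEq, ae_restrict_iff' hA] at hs0
  have hvol : volume (extChartAt I x₀ '' s) = 0 := by
    refine measure_mono_null (fun y hy => ?_) hs0
    exact fun hle => not_le.2 (hpos y (hsub' hy)) (ENNReal.ofReal_eq_zero.1 (hle hy))
  obtain ⟨y, hy⟩ := interior_extChartAt_image_nonempty (I := I) hs inter_subset_right
    ⟨hx₀, mem_chart_source H x₀⟩
  exact (isOpen_interior.measure_pos volume ⟨y, hy⟩).ne' (measure_mono_null interior_subset hvol)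

/-- A continuous function whose integrals against all test functions supported in the interior
vanish is zero, up to the boundary. -/
lemma IsSmoothMeasure.eqOn_zero_of_integral_smul_eq_zero [IsManifold I ∞ M] [T2Space M]
    [SigmaCompactSpace M] (hμ : IsSmoothMeasure I μ) {g : M → ℂ} {U : Set M} (hU : IsOpen U)
    (hg : Continuous g)
    (h : ∀ b : C^∞⟮I, M; ℝ⟯, HasCompactSupport b → tsupport b ⊆ U ∩ I.interior M →
      ∫ x, b x • g x ∂μ = 0) :
    ∀ x ∈ U, g x = 0 := by
  have := hμ.isLocallyFiniteMeasure
  have := hμ.isOpenPosMeasure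
  have : IsManifold I 1 M := IsManifold.of_le (n := ∞) (by simp)
  have hint : IsOpen (I.interior M) := I.isOpen_interior one_ne_zero
  have hUi := hU.inter hint
  have hae : ∀ᵐ x ∂μ, x ∈ U ∩ I.interior M → g x = 0 :=
    hUi.ae_eq_zero_of_integral_contMDiff_smul_eq_zero I
      (hg.locallyIntegrable.locallyIntegrableOn _) fun b hb hbc hbs => h ⟨b, hb⟩ hbc hbs
  have hEq : EqOn g 0 (U ∩ I.interior M) := by
    refine Measure.eqOn_open_of_ae_eq (μ := μ) ?_ hUi hg.continuousOn continuousOn_const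
    rwa [Filter.EventuallyEq, ae_restrict_iff' hUi.measurableSet]
  intro x hx
  -- Continuity and density of the interior carry the vanishing to the boundary points of `U`.
  have hd : x ∈ closure (U ∩ I.interior M) := (dense_interior.open_subset_closure_inter hU) hx
  exact (hEq.closure hg continuous_const) hd

end SmoothMeasure

/-! ### Local frames and measurability of sections -/

section MeasurableSections

variable {n : ℕ} {H : Type*} [TopologicalSpace H]
  {I : ModelWithCorners ℝ (EuclideanSpace ℝ (Fin n)) H}
  {M : Type*} [TopologicalSpace M] [ChartedSpace H M]
  {E₀ : Type*} [NormedAddCommGroup E₀] [NormedSpace ℂ E₀]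
  {E : M → Type*} [TopologicalSpace (TotalSpace E₀ E)]
  [∀ x, NormedAddCommGroup (E x)] [∀ x, InnerProductSpace ℂ (E x)]
  [FiberBundle E₀ E] [VectorBundle ℂ E₀ E] [VectorBundle ℝ E₀ E]
  {F₀ : Type*} [NormedAddCommGroup F₀] [NormedSpace ℂ F₀]
  {F : M → Type*} [TopologicalSpace (TotalSpace F₀ F)]
  [∀ x, NormedAddCommGroup (F x)] [∀ x, InnerProductSpace ℂ (F x)]
  [FiberBundle F₀ F] [VectorBundle ℂ F₀ F] [VectorBundle ℝ F₀ F]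

/-- The trivialization around `x₀` as a linear map on the fibre over `x`. -/
def trivMap (E₀ : Type*) [NormedAddCommGroup E₀] [NormedSpace ℂ E₀]
    (E : M → Type*) [TopologicalSpace (TotalSpace E₀ E)]
    [∀ x, NormedAddCommGroup (E x)] [∀ x, InnerProductSpace ℂ (E x)]
    [FiberBundle E₀ E] [VectorBundle ℂ E₀ E] (x₀ x : M) : E x →ₗ[ℂ] E₀ :=
  (trivializationAt E₀ E x₀).linearMapAt ℂ x

set_option linter.unusedSectionVars false in
lemma localRep_eq_trivMap {x₀ x : M} (hx : x ∈ (trivializationAt E₀ E x₀).baseSet)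
    (u : ∀ x, E x) : localRep E₀ x₀ u x = trivMap E₀ E x₀ x (u x) := by
  rw [trivMap, Trivialization.coe_linearMapAt_of_mem _ hx]
  rfl

set_option linter.unusedSectionVars false in
lemma finiteDimensional_fiber [FiniteDimensional ℂ E₀] (x : M) : FiniteDimensional ℂ (E x) :=
  LinearEquiv.finiteDimensional ((trivializationAt E₀ E x).continuousLinearEquivAt ℂ x
    (mem_baseSet_trivializationAt E₀ E x)).symm.toLinearEquiv

/-- Near every point there is a frame consisting of global smooth sections. -/
lemma exists_local_frame [T2Space M] [IsManifold I ∞ M] [ContMDiffVectorBundle ∞ E₀ E I]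
    {ι : Type*} [Fintype ι] (b : Module.Basis ι ℂ E₀) (y : M) :
    ∃ s : ι → SmoothSections I E₀ E, ∀ᶠ x in 𝓝 y, x ∈ (trivializationAt E₀ E y).baseSet ∧
      ∀ e : E x, e = ∑ i, b.repr (trivMap E₀ E y x e) i • (s i).1 x := by
  set e := trivializationAt E₀ E y
  have hbase : e.baseSet ∈ 𝓝 y := e.open_baseSet.mem_nhds (mem_baseSet_trivializationAt E₀ E y)
  obtain ⟨f, -, hf⟩ := (SmoothBumpFunction.nhds_basis_tsupport (I := I) y).mem_iff.1 hbase
  have hsm : ∀ i, ContMDiffOn I (I.prod 𝓘(ℝ, E₀)) ∞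
      (fun x => TotalSpace.mk' E₀ x (e.symm x (b i))) e.baseSet := by
    intro i
    rw [e.contMDiffOn_section_baseSet_iff]
    refine (contMDiffOn_const (c := b i)).congr fun x hx => ?_
    simp [e.apply_mk_symm hx]
  -- A bump function makes the local frame global without changing it near `y`.
  refine ⟨fun i => ⟨_, ContMDiffOn.smul_section_of_tsupport f.contMDiff.contMDiffOn e.open_baseSet
    hf (hsm i)⟩, ?_⟩
  filter_upwards [hbase, f.eventuallyEq_one] with x hx hfx
  refine ⟨hx, fun v => ?_⟩
  have h1 : ∀ i, ((f : M → ℝ) • fun x => e.symm x (b i)) x = e.symmₗ ℂ x (b i) := by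
    intro i
    rw [e.symmₗ_apply hx]
    simp [hfx]
  simp only [h1]
  rw [← e.symmₗ_linearMapAt (R := ℂ) hx v]
  conv_lhs => rw [← b.sum_repr (e.linearMapAt ℂ x v), map_sum]
  simp [trivMap, e, map_smul, e.symmₗ_linearMapAt (R := ℂ) hx v]

lemma continuousOn_localRep [ContMDiffVectorBundle ∞ E₀ E I] (s : SmoothSections I E₀ E) (x₀ : M) :
    ContinuousOn (localRep E₀ x₀ s.1) (trivializationAt E₀ E x₀).baseSet := by
  have h := (trivializationAt E₀ E x₀).contMDiffOn_section_baseSet_iff.1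
    (s.2.contMDiffOn (s := (trivializationAt E₀ E x₀).baseSet))
  exact h.continuousOn

lemma IsSmoothHermitian.continuous_inner (hE : IsSmoothHermitian I E₀ E)
    (s t : SmoothSections I E₀ E) : Continuous fun x => inner ℂ (s.1 x) (t.1 x) :=
  (hE s t).continuous

lemma IsSmoothHermitian.continuous_norm (hE : IsSmoothHermitian I E₀ E)
    (s : SmoothSections I E₀ E) : Continuous fun x => ‖s.1 x‖ := by
  simp_rw [norm_eq_sqrt_re_inner (𝕜 := ℂ)]
  exact (Complex.continuous_re.comp (hE.continuous_inner s s)).sqrt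

variable [MeasurableSpace M] [BorelSpace M] [SecondCountableTopology M] {μ : Measure M}

set_option linter.unusedSectionVars false in
-- By second countability, countably many of the neighbourhoods cover `U`.
lemma aestronglyMeasurable_of_locally {G : Type*} [TopologicalSpace G]
    [TopologicalSpace.PseudoMetrizableSpace G] {U : Set M} {f : M → G}
    (h : ∀ y ∈ U, ∃ V ∈ 𝓝 y, AEStronglyMeasurable f (μ.restrict (V ∩ U))) :
    AEStronglyMeasurable f (μ.restrict U) := by
  choose! V hV hf using h
  obtain ⟨T, hT, hTU⟩ := TopologicalSpace.isOpen_biUnion_countable U (fun y => interior (V y))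
    fun _ _ => isOpen_interior
  have hsub : U ⊆ ⋃ i : T, (V i.1 ∩ U) := by
    intro y hy
    have : y ∈ ⋃ i ∈ T, interior (V i) := by
      rw [hTU.2]
      exact mem_biUnion hy (mem_interior_iff_mem_nhds.2 (hV y hy))
    obtain ⟨i, hi, hyi⟩ := mem_iUnion₂.1 this
    exact mem_iUnion.2 ⟨⟨i, hi⟩, interior_subset hyi, hy⟩
  have := hTU.1.to_subtype
  exact (aestronglyMeasurable_iUnion_iff.2 fun i : T => hf i (hT i.2)).mono_set hsub

/-- A family of linear functionals on the fibres which is continuous on smooth sections is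
measurable on measurable sections. -/
lemma AEMeasurableSection.apply [T2Space M] [IsManifold I ∞ M] [ContMDiffVectorBundle ∞ E₀ E I]
    [FiniteDimensional ℂ E₀] {G : Type*} [NormedAddCommGroup G] [NormedSpace ℂ G]
    {U : Set M} (hU : IsOpen U) {ℓ : ∀ x, E x →ₗ[ℂ] G}
    (hℓ : ∀ s : SmoothSections I E₀ E,
      AEStronglyMeasurable (fun x => ℓ x (s.1 x)) (μ.restrict U))
    {u : ∀ x, E x} (hu : AEMeasurableSection E₀ μ u) :
    AEStronglyMeasurable (fun x => ℓ x (u x)) (μ.restrict U) := by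
  refine aestronglyMeasurable_of_locally fun y hy => ?_
  let b := Module.finBasis ℂ E₀
  obtain ⟨s, hs⟩ := exists_local_frame (I := I) (E := E) b y
  obtain ⟨V, hV, hVo, hyV⟩ := eventually_nhds_iff.1 hs
  refine ⟨V, hVo.mem_nhds hyV, ?_⟩
  have hm : MeasurableSet (V ∩ U) := hVo.measurableSet.inter hU.measurableSet
  -- Expansion in the frame separates the measurable coordinates of `u` from the values of `ℓ` on
  -- smooth sections.
  have h1 : AEStronglyMeasurable
      (fun x => ∑ i, b.repr (localRep E₀ y u x) i • ℓ x ((s i).1 x)) (μ.restrict (V ∩ U)) := by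
    refine Finset.aestronglyMeasurable_fun_sum _ fun i _ => AEStronglyMeasurable.smul ?_ ?_
    · have hc : Continuous (b.coord i) := LinearMap.continuous_of_finiteDimensional _
      exact hc.comp_aestronglyMeasurable ((hu y).mono_set fun x hx => (hV x hx.1).1)
    · exact (hℓ (s i)).mono_set inter_subset_right
  refine h1.congr ?_
  filter_upwards [ae_restrict_mem hm] with x hx
  obtain ⟨hxb, hx'⟩ := hV x hx.1
  conv_rhs => rw [hx' (u x), map_sum]
  simp [localRep_eq_trivMap hxb]

/-- A fibrewise linear operator which maps smooth sections to smooth sections maps measurable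
sections to measurable sections. -/
lemma AEMeasurableSection.map [T2Space M] [IsManifold I ∞ M] [ContMDiffVectorBundle ∞ E₀ E I]
    [ContMDiffVectorBundle ∞ F₀ F I] [FiniteDimensional ℂ E₀] {B : ∀ x, E x →ₗ[ℂ] F x}
    (hB : ∀ s : SmoothSections I E₀ E, ∃ t : SmoothSections I F₀ F, ∀ x, B x (s.1 x) = t.1 x)
    {u : ∀ x, E x} (hu : AEMeasurableSection E₀ μ u) :
    AEMeasurableSection F₀ μ (fun x => B x (u x)) := by
  intro x₀
  set U := (trivializationAt F₀ F x₀).baseSet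
  have hU : IsOpen U := (trivializationAt F₀ F x₀).open_baseSet
  have h := hu.apply (I := I) (μ := μ) hU (ℓ := fun x => (trivMap F₀ F x₀ x) ∘ₗ B x) fun s => by
    obtain ⟨t, ht⟩ := hB s
    refine ((continuousOn_localRep t x₀).aestronglyMeasurable hU.measurableSet).congr ?_
    filter_upwards [ae_restrict_mem hU.measurableSet] with x hx
    simp [localRep_eq_trivMap hx, ht]
  refine h.congr ?_
  filter_upwards [ae_restrict_mem hU.measurableSet] with x hx
  simp [localRep_eq_trivMap hx]

set_option linter.unusedSectionVars false in
lemma AEMeasurableSection.add {u v : ∀ x, E x} (hu : AEMeasurableSection E₀ μ u)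
    (hv : AEMeasurableSection E₀ μ v) : AEMeasurableSection E₀ μ (u + v) := by
  intro x₀
  refine ((hu x₀).add (hv x₀)).congr ?_
  filter_upwards [ae_restrict_mem (trivializationAt E₀ E x₀).open_baseSet.measurableSet] with x hx
  simp [localRep_eq_trivMap hx]

section

variable [T2Space M] [IsManifold I ∞ M] [ContMDiffVectorBundle ∞ E₀ E I] [FiniteDimensional ℂ E₀]
  {u : ∀ x, E x}

lemma AEMeasurableSection.inner_smooth (hE : IsSmoothHermitian I E₀ E)
    (hu : AEMeasurableSection E₀ μ u) (s : SmoothSections I E₀ E) :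
    AEStronglyMeasurable (fun x => inner ℂ (s.1 x) (u x)) μ := by
  have h := hu.apply (I := I) (μ := μ) isOpen_univ (ℓ := fun x => (innerSL ℂ (s.1 x)).toLinearMap)
    fun t => (hE.continuous_inner s t).aestronglyMeasurable
  simpa using h

/-- The squared norm is not linear in `u`, so one factor is expanded in a local frame and the other
is handled by `inner_smooth`. -/
lemma AEMeasurableSection.enorm (hE : IsSmoothHermitian I E₀ E)
    (hu : AEMeasurableSection E₀ μ u) : AEMeasurable (fun x => ‖u x‖ₑ) μ := by
  have h : AEStronglyMeasurable (fun x => inner ℂ (u x) (u x)) (μ.restrict univ) := by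
    refine aestronglyMeasurable_of_locally fun y _ => ?_
    let b := Module.finBasis ℂ E₀
    obtain ⟨s, hs⟩ := exists_local_frame (I := I) (E := E) b y
    obtain ⟨V, hV, hVo, hyV⟩ := eventually_nhds_iff.1 hs
    refine ⟨V, hVo.mem_nhds hyV, ?_⟩
    rw [inter_univ]
    have h1 : AEStronglyMeasurable (fun x => ∑ i, (starRingEnd ℂ) (b.repr (localRep E₀ y u x) i) *
        inner ℂ ((s i).1 x) (u x)) (μ.restrict V) := by
      refine Finset.aestronglyMeasurable_fun_sum _ fun i _ => AEStronglyMeasurable.mul ?_ ?_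
      · have hc : Continuous (b.coord i) := LinearMap.continuous_of_finiteDimensional _
        exact (Complex.continuous_conj.comp hc).comp_aestronglyMeasurable
          ((hu y).mono_set fun x hx => (hV x hx).1)
      · exact (hu.inner_smooth hE (s i)).restrict
    refine h1.congr ?_
    filter_upwards [ae_restrict_mem hVo.measurableSet] with x hx
    obtain ⟨hxb, hx'⟩ := hV x hx
    conv_rhs => rw [hx' (u x), sum_inner]
    -- The rewriting above expanded both arguments of the inner product; the right one is folded
    -- back.
    rw [← hx' (u x)]
    simp [localRep_eq_trivMap hxb, inner_smul_left]
  rw [Measure.restrict_univ] at h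
  have h2 : AEStronglyMeasurable (fun x => ‖u x‖) μ := by
    simp_rw [norm_eq_sqrt_re_inner (𝕜 := ℂ)]
    exact (Real.continuous_sqrt.comp Complex.continuous_re).comp_aestronglyMeasurable h
  simpa using h2.enorm

end

end MeasurableSections

/-! ### Locality and the commutator identity for formal adjoints -/

section Commutators

variable {n : ℕ} {H : Type*} [TopologicalSpace H]
  {I : ModelWithCorners ℝ (EuclideanSpace ℝ (Fin n)) H}
  {M : Type*} [TopologicalSpace M] [ChartedSpace H M]
  {E₀ : Type*} [NormedAddCommGroup E₀] [NormedSpace ℂ E₀]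
  {E : M → Type*} [TopologicalSpace (TotalSpace E₀ E)]
  [∀ x, NormedAddCommGroup (E x)] [∀ x, InnerProductSpace ℂ (E x)]
  [FiberBundle E₀ E] [VectorBundle ℂ E₀ E] [VectorBundle ℝ E₀ E]
  {F₀ : Type*} [NormedAddCommGroup F₀] [NormedSpace ℂ F₀]
  {F : M → Type*} [TopologicalSpace (TotalSpace F₀ F)]
  [∀ x, NormedAddCommGroup (F x)] [∀ x, InnerProductSpace ℂ (F x)]
  [FiberBundle F₀ F] [VectorBundle ℂ F₀ F] [VectorBundle ℝ F₀ F]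

/-- An operator on smooth sections is local if it does not increase supports. -/
def IsLocal (T : SmoothSections I E₀ E →ₗ[ℂ] SmoothSections I F₀ F) : Prop :=
  ∀ (u : SmoothSections I E₀ E) (x : M), (∀ᶠ y in 𝓝 x, u.1 y = 0) → (T u).1 x = 0

lemma IsFirstOrder.isLocal {D : SmoothSections I E₀ E →ₗ[ℂ] SmoothSections I F₀ F}
    (hD : IsFirstOrder D) : IsLocal D := by
  intro u x hu
  refine hD u x ⟨hu.self_of_nhds, ?_⟩
  have hev : localRep E₀ x u.1 =ᶠ[𝓝 x] fun _ => 0 := by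
    filter_upwards [hu, (trivializationAt E₀ E x).open_baseSet.mem_nhds
      (mem_baseSet_trivializationAt E₀ E x)] with y hy hyb
    rw [localRep_eq_trivMap hyb, hy, map_zero]
  rw [hev.mfderiv_eq, mfderiv_const]
  rfl

/-- The commutator `[T, f]` applied to a smooth section, as a smooth section. -/
def commutatorSection (T : SmoothSections I E₀ E →ₗ[ℂ] SmoothSections I F₀ F) (f : C^∞⟮I, M; ℝ⟯)
    (u : SmoothSections I E₀ E) : SmoothSections I F₀ F :=
  T (mulFun f u) - mulFun f (T u)

lemma commutatorSection_apply (T : SmoothSections I E₀ E →ₗ[ℂ] SmoothSections I F₀ F)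
    (f : C^∞⟮I, M; ℝ⟯) (u : SmoothSections I E₀ E) (x : M) :
    (commutatorSection T f u).1 x = commutatorAt T f u x := rfl

lemma mulFun_apply (f : C^∞⟮I, M; ℝ⟯) (u : SmoothSections I E₀ E) (x : M) :
    (mulFun f u).1 x = f x • u.1 x := rfl

lemma mulFun_add (f : C^∞⟮I, M; ℝ⟯) (u v : SmoothSections I E₀ E) :
    mulFun f (u + v) = mulFun f u + mulFun f v := by
  ext x
  exact smul_add (f x) (u.1 x) (v.1 x)

lemma mulFun_smul (f : C^∞⟮I, M; ℝ⟯) (c : ℂ) (u : SmoothSections I E₀ E) :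
    mulFun f (c • u) = c • mulFun f u := by
  ext x
  exact smul_comm (f x) c (u.1 x)

lemma commutatorAt_add (T : SmoothSections I E₀ E →ₗ[ℂ] SmoothSections I F₀ F)
    (f : C^∞⟮I, M; ℝ⟯) (u v : SmoothSections I E₀ E) (x : M) :
    commutatorAt T f (u + v) x = commutatorAt T f u x + commutatorAt T f v x := by
  simp only [commutatorAt, mulFun_add, map_add, Submodule.coe_add, Pi.add_apply, smul_add]
  abel

lemma commutatorAt_smul (T : SmoothSections I E₀ E →ₗ[ℂ] SmoothSections I F₀ F)
    (f : C^∞⟮I, M; ℝ⟯) (c : ℂ) (u : SmoothSections I E₀ E) (x : M) :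
    commutatorAt T f (c • u) x = c • commutatorAt T f u x := by
  simp only [commutatorAt, mulFun_smul, map_smul, Submodule.coe_smul, Pi.smul_apply, smul_sub]
  rw [smul_comm c (f x)]

/-- The commutator has order zero, so `b` may be replaced by the constant `b x`. -/
lemma commutatorAt_mulFun {D : SmoothSections I E₀ E →ₗ[ℂ] SmoothSections I F₀ F}
    (hD : IsFirstOrder D) (f b : C^∞⟮I, M; ℝ⟯) (u : SmoothSections I E₀ E) (x : M) :
    commutatorAt D f (mulFun b u) x = b x • commutatorAt D f u x := by
  have h : commutatorAt D f (mulFun b u) x = commutatorAt D f (((b x : ℝ) : ℂ) • u) x :=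
    commutatorAt_congr hD rfl (by simp [mulFun_apply])
  rw [h, commutatorAt_smul, Complex.coe_smul]

lemma inner_ofReal_smul_left {V : Type*} [NormedAddCommGroup V] [InnerProductSpace ℂ V] (r : ℝ)
    (a b : V) : inner ℂ (r • a) b = (r : ℂ) * inner ℂ a b := by
  rw [← Complex.coe_smul, inner_smul_left, Complex.conj_ofReal]

lemma inner_ofReal_smul_right {V : Type*} [NormedAddCommGroup V] [InnerProductSpace ℂ V] (r : ℝ)
    (a b : V) : inner ℂ a (r • b) = (r : ℂ) * inner ℂ a b := by
  rw [← Complex.coe_smul, inner_smul_right]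

section Symbol

variable [T2Space M] [IsManifold I ∞ M] [ContMDiffVectorBundle ∞ E₀ E I]

/-- The principal symbol of a first-order operator at the differential of a function, as a linear
map between fibres. -/
def symbolMap {D : SmoothSections I E₀ E →ₗ[ℂ] SmoothSections I F₀ F} (hD : IsFirstOrder D)
    (f : C^∞⟮I, M; ℝ⟯) (x : M) : E x →ₗ[ℂ] F x where
  toFun e := principalSymbol D x (mfderiv I 𝓘(ℝ, ℝ) f x) e
  map_add' e e' := by
    obtain ⟨u, rfl⟩ := exists_section_eq (I := I) (E₀ := E₀) x e
    obtain ⟨v, rfl⟩ := exists_section_eq (I := I) (E₀ := E₀) x e'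
    have h := principalSymbol_apply hD f (u + v) x
    rw [commutatorAt_add] at h
    rw [principalSymbol_apply hD f u x, principalSymbol_apply hD f v x]
    exact h
  map_smul' c e := by
    obtain ⟨u, rfl⟩ := exists_section_eq (I := I) (E₀ := E₀) x e
    have h := principalSymbol_apply hD f (c • u) x
    rw [commutatorAt_smul] at h
    rw [principalSymbol_apply hD f u x]
    exact h

lemma symbolMap_apply {D : SmoothSections I E₀ E →ₗ[ℂ] SmoothSections I F₀ F}
    (hD : IsFirstOrder D) (f : C^∞⟮I, M; ℝ⟯) (u : SmoothSections I E₀ E) (x : M) :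
    symbolMap hD f x (u.1 x) = commutatorAt D f u x :=
  principalSymbol_apply hD f u x

end Symbol

variable [MeasurableSpace M] [BorelSpace M] [T2Space M] {μ : Measure M}

lemma IsSmoothHermitian.integrable_inner [IsLocallyFiniteMeasure μ]
    (hE : IsSmoothHermitian I E₀ E) {s t : SmoothSections I E₀ E} {K : Set M} (hK : IsCompact K)
    (h : ∀ x ∉ K, s.1 x = 0 ∨ t.1 x = 0) :
    Integrable (fun x => inner ℂ (s.1 x) (t.1 x)) μ := by
  refine (hE.continuous_inner s t).integrable_of_hasCompactSupport
    (HasCompactSupport.intro hK fun x hx => ?_)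
  rcases h x hx with h | h <;> simp [h]

omit [MeasurableSpace M] [BorelSpace M] in
lemma IsLocal.eq_zero_of_notMem {T : SmoothSections I E₀ E →ₗ[ℂ] SmoothSections I F₀ F}
    (hT : IsLocal T) {u : SmoothSections I E₀ E} {K : Set M} (hK : IsCompact K)
    (hu : ∀ x ∉ K, u.1 x = 0) : ∀ x ∉ K, (T u).1 x = 0 := fun x hx =>
  hT u x (Filter.eventually_of_mem (hK.isClosed.isOpen_compl.mem_nhds hx) hu)

omit [MeasurableSpace M] [BorelSpace M] [T2Space M] in
lemma isCC_mulFun {b : C^∞⟮I, M; ℝ⟯} (hb : HasCompactSupport b)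
    (hbs : tsupport b ⊆ I.interior M) (u : SmoothSections I E₀ E) : IsCC (mulFun b u) :=
  ⟨tsupport b, hb, hbs, fun x hx => by simp [mulFun_apply, image_eq_zero_of_notMem_tsupport hx]⟩

variable [IsManifold I ∞ M] [SigmaCompactSpace M]
  {D : SmoothSections I E₀ E →ₗ[ℂ] SmoothSections I F₀ F}
  {Ddag : SmoothSections I F₀ F →ₗ[ℂ] SmoothSections I E₀ E}

/-- The formal adjoint of a first-order operator is local. -/
lemma IsFormalAdjoint.isLocal (hμ : IsSmoothMeasure I μ) (hE : IsSmoothHermitian I E₀ E)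
    (hD : IsFirstOrder D) (h : IsFormalAdjoint μ D Ddag) : IsLocal Ddag := by
  intro v x hv
  obtain ⟨U, hU, hUo, hxU⟩ := eventually_nhds_iff.1 hv
  have key := hμ.eqOn_zero_of_integral_smul_eq_zero hUo
    (hE.continuous_inner (Ddag v) (Ddag v)) fun b hb hbs => by
      -- Testing with `b D†v` gives `∫ b |D†v|² = ⟨D (b D†v), v⟩`. The right side vanishes, as `v =
      -- 0` on the support of `b` and `D (b D†v) = 0` off it.
      have hcc := isCC_mulFun hb (hbs.trans inter_subset_right) (Ddag v)
      have h1 := h (mulFun b (Ddag v)) v hcc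
      have h2 : ∀ x, inner ℂ ((D (mulFun b (Ddag v))).1 x) (v.1 x) = 0 := by
        intro x
        by_cases hx : x ∈ tsupport b
        · rw [hU x (hbs hx).1, inner_zero_right]
        · rw [hD.isLocal.eq_zero_of_notMem hb.isCompact (fun y hy => by
            simp [mulFun_apply, image_eq_zero_of_notMem_tsupport hy]) x hx, inner_zero_left]
      simp only [h2, integral_zero] at h1
      rw [h1]
      refine integral_congr_ae (Filter.Eventually.of_forall fun x => ?_)
      beta_reduce
      rw [mulFun_apply, inner_ofReal_smul_left, Complex.real_smul]
  exact inner_self_eq_zero.1 (key x hxU)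

/-- The commutators of a first-order operator and of its formal adjoint with a real function are
fibrewise skew-adjoint to each other, up to the boundary. -/
lemma IsFormalAdjoint.inner_commutatorAt_add (hμ : IsSmoothMeasure I μ)
    (hE : IsSmoothHermitian I E₀ E) (hF : IsSmoothHermitian I F₀ F)
    (hD : IsFirstOrder D) (h : IsFormalAdjoint μ D Ddag) (f : C^∞⟮I, M; ℝ⟯)
    (u : SmoothSections I E₀ E) (v : SmoothSections I F₀ F) (x : M) :
    inner ℂ (commutatorAt D f u x) (v.1 x) + inner ℂ (u.1 x) (commutatorAt Ddag f v x) = 0 := by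
  have := hμ.isLocallyFiniteMeasure
  have hcont : Continuous fun x => inner ℂ (commutatorAt D f u x) (v.1 x) +
      inner ℂ (u.1 x) (commutatorAt Ddag f v x) :=
    (hF.continuous_inner (commutatorSection D f u) v).add
      (hE.continuous_inner u (commutatorSection Ddag f v))
  refine hμ.eqOn_zero_of_integral_smul_eq_zero isOpen_univ hcont (fun b hb hbs => ?_) x (mem_univ x)
  rw [univ_inter] at hbs
  -- The factor `b` turns `u` into an admissible test section `w`. The claim is then the difference
  -- of the adjoint relations for the pairs `(f w, v)` and `(w, f v)`.
  set w := mulFun b u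
  have hw : ∀ x ∉ tsupport b, w.1 x = 0 := fun x hx => by
    simp [w, mulFun_apply, image_eq_zero_of_notMem_tsupport hx]
  have hfw : ∀ x ∉ tsupport b, (mulFun f w).1 x = 0 := fun x hx => by
    simp [mulFun_apply, hw x hx]
  have hK : IsCompact (tsupport b) := hb
  have hwcc : IsCC w := ⟨_, hK, hbs, hw⟩
  have hfwcc : IsCC (mulFun f w) := ⟨_, hK, hbs, hfw⟩
  have e1 := h (mulFun f w) v hfwcc
  have e2 := h w (mulFun f v) hwcc
  have i1 : Integrable (fun x => inner ℂ ((D (mulFun f w)).1 x) (v.1 x)) μ :=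
    hF.integrable_inner hK fun x hx => Or.inl (hD.isLocal.eq_zero_of_notMem hK hfw x hx)
  have i2 : Integrable (fun x => inner ℂ ((mulFun f w).1 x) ((Ddag v).1 x)) μ :=
    hE.integrable_inner hK fun x hx => Or.inl (hfw x hx)
  have i3 : Integrable (fun x => inner ℂ ((D w).1 x) ((mulFun f v).1 x)) μ :=
    hF.integrable_inner hK fun x hx => Or.inl (hD.isLocal.eq_zero_of_notMem hK hw x hx)
  have i4 : Integrable (fun x => inner ℂ (w.1 x) ((Ddag (mulFun f v)).1 x)) μ :=
    hE.integrable_inner hK fun x hx => Or.inl (hw x hx)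
  have hpt : ∀ x, b x • (inner ℂ (commutatorAt D f u x) (v.1 x) +
      inner ℂ (u.1 x) (commutatorAt Ddag f v x)) =
      (inner ℂ ((D (mulFun f w)).1 x) (v.1 x) - inner ℂ ((D w).1 x) ((mulFun f v).1 x)) +
      (inner ℂ (w.1 x) ((Ddag (mulFun f v)).1 x) -
        inner ℂ ((mulFun f w).1 x) ((Ddag v).1 x)) := by
    intro x
    have h1 : inner ℂ ((D (mulFun f w)).1 x) (v.1 x) - inner ℂ ((D w).1 x) ((mulFun f v).1 x) =
        inner ℂ (commutatorAt D f w x) (v.1 x) := by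
      rw [commutatorAt, inner_sub_left, mulFun_apply f v, inner_ofReal_smul_left,
        inner_ofReal_smul_right]
    have h2 : inner ℂ (w.1 x) ((Ddag (mulFun f v)).1 x) -
        inner ℂ ((mulFun f w).1 x) ((Ddag v).1 x) =
        inner ℂ (w.1 x) (commutatorAt Ddag f v x) := by
      rw [commutatorAt, inner_sub_right, mulFun_apply f w, inner_ofReal_smul_left,
        inner_ofReal_smul_right]
    rw [h1, h2, commutatorAt_mulFun hD, smul_add]
    simp [w, mulFun_apply, Complex.real_smul]
  simp_rw [hpt]
  have i13 : Integrable (fun x => inner ℂ ((D (mulFun f w)).1 x) (v.1 x) -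
      inner ℂ ((D w).1 x) ((mulFun f v).1 x)) μ := i1.sub i3
  have i42 : Integrable (fun x => inner ℂ (w.1 x) ((Ddag (mulFun f v)).1 x) -
      inner ℂ ((mulFun f w).1 x) ((Ddag v).1 x)) μ := i4.sub i2
  rw [integral_add i13 i42, integral_sub i1 i3, integral_sub i4 i2, e1, e2]
  ring

end Commutators

/-! ### Square integrable sections and cutoffs -/

section Cutoff

variable {M : Type*} [TopologicalSpace M]
  {E₀ : Type*} [NormedAddCommGroup E₀] [NormedSpace ℂ E₀]
  {E : M → Type*} [TopologicalSpace (TotalSpace E₀ E)]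
  [∀ x, NormedAddCommGroup (E x)] [∀ x, InnerProductSpace ℂ (E x)]
  [FiberBundle E₀ E] [VectorBundle ℂ E₀ E] [VectorBundle ℝ E₀ E]
  {F₀ : Type*} [NormedAddCommGroup F₀] [NormedSpace ℂ F₀]
  {F : M → Type*} [TopologicalSpace (TotalSpace F₀ F)]
  [∀ x, NormedAddCommGroup (F x)] [∀ x, InnerProductSpace ℂ (F x)]
  [FiberBundle F₀ F] [VectorBundle ℂ F₀ F] [VectorBundle ℝ F₀ F]
  [MeasurableSpace M] {μ : Measure M}

omit [TopologicalSpace M] [∀ x, InnerProductSpace ℂ (E x)] in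
lemma l2Norm_sq (u : ∀ x, E x) : l2Norm μ u ^ 2 = ∫⁻ x, ‖u x‖ₑ ^ 2 ∂μ := by
  rw [l2Norm, ← ENNReal.rpow_natCast, ← ENNReal.rpow_mul]
  norm_num

omit [TopologicalSpace M] [∀ x, InnerProductSpace ℂ (E x)] in
lemma l2Norm_lt_top_iff (u : ∀ x, E x) : l2Norm μ u < ⊤ ↔ ∫⁻ x, ‖u x‖ₑ ^ 2 ∂μ < ⊤ := by
  rw [l2Norm, ENNReal.rpow_lt_top_iff_of_pos (by norm_num)]

lemma enorm_add_sq_le {V : Type*} [NormedAddCommGroup V] (a b : V) :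
    ‖a + b‖ₑ ^ 2 ≤ 2 * ‖a‖ₑ ^ 2 + 2 * ‖b‖ₑ ^ 2 := by
  have h : ‖a + b‖₊ ^ 2 ≤ 2 * ‖a‖₊ ^ 2 + 2 * ‖b‖₊ ^ 2 := by
    rw [← NNReal.coe_le_coe]
    push_cast
    nlinarith [norm_add_le a b, norm_nonneg (a + b), sq_nonneg (‖a‖ - ‖b‖), norm_nonneg a,
      norm_nonneg b]
  simp only [enorm_eq_nnnorm]
  exact_mod_cast h

variable {n : ℕ} {H : Type*} [TopologicalSpace H]
  {I : ModelWithCorners ℝ (EuclideanSpace ℝ (Fin n)) H} [ChartedSpace H M]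
  [BorelSpace M] [SecondCountableTopology M] [T2Space M] [IsManifold I ∞ M]
  [ContMDiffVectorBundle ∞ E₀ E I] [FiniteDimensional ℂ E₀]
  [ContMDiffVectorBundle ∞ F₀ F I] [FiniteDimensional ℂ F₀]

lemma MemL2.add (hE : IsSmoothHermitian I E₀ E) {u v : ∀ x, E x} (hu : MemL2 E₀ μ u)
    (hv : MemL2 E₀ μ v) : MemL2 E₀ μ (u + v) := by
  refine ⟨hu.1.add hv.1, (l2Norm_lt_top_iff _).2 ?_⟩
  have h1 := (l2Norm_lt_top_iff _).1 hu.2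
  have h2 := (l2Norm_lt_top_iff _).1 hv.2
  calc ∫⁻ x, ‖(u + v) x‖ₑ ^ 2 ∂μ ≤ ∫⁻ x, (2 * ‖u x‖ₑ ^ 2 + 2 * ‖v x‖ₑ ^ 2) ∂μ :=
        lintegral_mono fun x => enorm_add_sq_le _ _
    _ = 2 * ∫⁻ x, ‖u x‖ₑ ^ 2 ∂μ + 2 * ∫⁻ x, ‖v x‖ₑ ^ 2 ∂μ := by
        rw [lintegral_add_left' (((hu.1.enorm hE).pow_const 2).const_mul 2),
          lintegral_const_mul' _ _ (by simp), lintegral_const_mul' _ _ (by simp)]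
    _ < ⊤ := by finiteness

omit [FiniteDimensional ℂ F₀] in
/-- Bounded fibrewise operators which preserve smoothness act on square integrable sections. -/
lemma MemL2.map {B : ∀ x, E x →ₗ[ℂ] F x}
    (hB : ∀ s : SmoothSections I E₀ E, ∃ t : SmoothSections I F₀ F, ∀ x, B x (s.1 x) = t.1 x)
    {c : ℝ} (hc : ∀ x e, ‖B x e‖ ≤ c * ‖e‖) {u : ∀ x, E x} (hu : MemL2 E₀ μ u) :
    MemL2 F₀ μ (fun x => B x (u x)) := by
  refine ⟨hu.1.map (I := I) hB, (l2Norm_lt_top_iff _).2 ?_⟩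
  have h1 := (l2Norm_lt_top_iff _).1 hu.2
  have hle : ∀ x, ‖B x (u x)‖ₑ ≤ ENNReal.ofReal c * ‖u x‖ₑ := by
    intro x
    rw [← ofReal_norm, ← ofReal_norm, ← ENNReal.ofReal_mul' (norm_nonneg _)]
    exact ENNReal.ofReal_le_ofReal (hc x _)
  calc ∫⁻ x, ‖B x (u x)‖ₑ ^ 2 ∂μ ≤ ∫⁻ x, ENNReal.ofReal c ^ 2 * ‖u x‖ₑ ^ 2 ∂μ :=
        lintegral_mono fun x => (pow_le_pow_left' (hle x) 2).trans_eq (mul_pow _ _ _)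
    _ = ENNReal.ofReal c ^ 2 * ∫⁻ x, ‖u x‖ₑ ^ 2 ∂μ := lintegral_const_mul' _ _ (by simp)
    _ < ⊤ := by finiteness

lemma MemL2.mulFun (f : C^∞⟮I, M; ℝ⟯) {c : ℝ} (hf : ∀ x, |f x| ≤ c) {u : ∀ x, E x}
    (hu : MemL2 E₀ μ u) : MemL2 E₀ μ (fun x => f x • u x) := by
  have h := hu.map (I := I) (F := E) (F₀ := E₀) (B := fun x => ((f x : ℝ) : ℂ) • LinearMap.id)
    (c := c) (fun s => ⟨FirstOrderCompleteness.mulFun f s, fun x => by simp [mulFun_apply]⟩)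
    fun x e => by
      simp only [LinearMap.smul_apply, LinearMap.id_coe, id_eq, Complex.coe_smul, norm_smul,
        Real.norm_eq_abs]
      exact mul_le_mul_of_nonneg_right (hf x) (norm_nonneg _)
  simpa using h

lemma MemL2.integrable_inner [IsLocallyFiniteMeasure μ] (hE : IsSmoothHermitian I E₀ E)
    {u : ∀ x, E x} (hu : MemL2 E₀ μ u) {s : SmoothSections I E₀ E} {K : Set M} (hK : IsCompact K)
    (hs : ∀ x ∉ K, s.1 x = 0) : Integrable (fun x => inner ℂ (s.1 x) (u x)) μ := by
  refine ⟨hu.1.inner_smooth hE s, ?_⟩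
  have h1 := (l2Norm_lt_top_iff _).1 hu.2
  have h2 : Integrable (fun x => ‖s.1 x‖ ^ 2) μ :=
    ((hE.continuous_norm s).pow 2).integrable_of_hasCompactSupport
      (HasCompactSupport.intro hK fun x hx => by simp [hs x hx])
  have h3 : ∫⁻ x, ‖s.1 x‖ₑ ^ 2 ∂μ < ⊤ := by simpa [HasFiniteIntegral] using h2.2
  calc ∫⁻ x, ‖(inner ℂ (s.1 x) (u x) : ℂ)‖ₑ ∂μ ≤ ∫⁻ x, (‖s.1 x‖ₑ ^ 2 + ‖u x‖ₑ ^ 2) ∂μ := by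
        refine lintegral_mono fun x => ?_
        have h : ‖(inner ℂ (s.1 x) (u x) : ℂ)‖₊ ≤ ‖s.1 x‖₊ ^ 2 + ‖u x‖₊ ^ 2 := by
          rw [← NNReal.coe_le_coe]
          push_cast
          nlinarith [norm_inner_le_norm (𝕜 := ℂ) (s.1 x) (u x), sq_nonneg (‖s.1 x‖ - ‖u x‖),
            norm_nonneg (s.1 x), norm_nonneg (u x),
            mul_nonneg (norm_nonneg (s.1 x)) (norm_nonneg (u x))]
        simp only [enorm_eq_nnnorm]
        exact_mod_cast h
    _ = ∫⁻ x, ‖s.1 x‖ₑ ^ 2 ∂μ + ∫⁻ x, ‖u x‖ₑ ^ 2 ∂μ :=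
        lintegral_add_right' _ ((hu.1.enorm hE).pow_const 2)
    _ < ⊤ := by finiteness

/-- The product rule for the Hilbert space adjoint of a local operator `T` and a bounded function
whose commutator with `T` has a bounded fibrewise adjoint. -/
lemma smul_mem_adjointGraph [IsLocallyFiniteMeasure μ] (hE : IsSmoothHermitian I E₀ E)
    (hF : IsSmoothHermitian I F₀ F)
    {T : SmoothSections I F₀ F →ₗ[ℂ] SmoothSections I E₀ E} (hT : IsLocal T)
    {f : C^∞⟮I, M; ℝ⟯} {c₀ : ℝ} (hf : ∀ x, |f x| ≤ c₀) {B : ∀ x, E x →ₗ[ℂ] F x}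
    (hB : ∀ s : SmoothSections I E₀ E, ∃ t : SmoothSections I F₀ F, ∀ x, B x (s.1 x) = t.1 x)
    {c : ℝ} (hc : ∀ x e, ‖B x e‖ ≤ c * ‖e‖)
    (hBT : ∀ (φ : SmoothSections I F₀ F) (x : M) (e : E x),
      inner ℂ (commutatorAt T f φ x) e + inner ℂ (φ.1 x) (B x e) = 0)
    {u : ∀ x, E x} {w : ∀ x, F x} (h : (u, w) ∈ adjointGraph μ T) :
    ((fun x => f x • u x), (fun x => f x • w x) + fun x => B x (u x)) ∈ adjointGraph μ T := by
  obtain ⟨hu, hw, h⟩ := h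
  refine ⟨hu.mulFun f hf, (hw.mulFun f hf).add hF (hu.map hB hc), fun φ hφ => ?_⟩
  obtain ⟨K, hK, hKi, hφK⟩ := hφ
  have hfφ : ∀ x ∉ K, (mulFun f φ).1 x = 0 := fun x hx => by simp [mulFun_apply, hφK x hx]
  have e1 := h (mulFun f φ) ⟨K, hK, hKi, hfφ⟩
  dsimp only at e1 ⊢
  have i1 : Integrable (fun x => inner ℂ ((T (mulFun f φ)).1 x) (u x)) μ :=
    hu.integrable_inner hE hK (hT.eq_zero_of_notMem hK hfφ)
  have i2 : Integrable (fun x => inner ℂ ((mulFun f φ).1 x) (w x)) μ :=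
    hw.integrable_inner hF hK hfφ
  have i3 : Integrable (fun x => inner ℂ (φ.1 x) (B x (u x))) μ :=
    (hu.map (I := I) hB hc).integrable_inner hF hK hφK
  -- Pointwise `⟨Tφ, f u⟩ = ⟨T(f φ), u⟩ - ⟨[T, f] φ, u⟩`, and `hBT` turns the last term into `+⟨φ, B
  -- u⟩`.
  have h1 : ∀ x, inner ℂ ((T φ).1 x) (f x • u x) =
      inner ℂ ((T (mulFun f φ)).1 x) (u x) + inner ℂ (φ.1 x) (B x (u x)) := by
    intro x
    have h2 := hBT φ x (u x)
    rw [commutatorAt, inner_sub_left, inner_ofReal_smul_left] at h2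
    rw [inner_ofReal_smul_right]
    linear_combination -h2
  have h3 : ∀ x, inner ℂ (φ.1 x) (((fun x => f x • w x) + fun x => B x (u x)) x) =
      inner ℂ ((mulFun f φ).1 x) (w x) + inner ℂ (φ.1 x) (B x (u x)) := by
    intro x
    rw [Pi.add_apply, inner_add_right, inner_ofReal_smul_right, mulFun_apply,
      inner_ofReal_smul_left]
  simp_rw [h1, h3]
  rw [integral_add i1 i3, integral_add i2 i3, e1]

end Cutoff

/-! ### Completeness from a sequence of cutoffs -/

/-- With `v = A* w`, the bound is `‖v‖² = ⟨A v, w⟩ ≤ c ‖v‖ ‖w‖` divided by `‖v‖`. -/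
lemma norm_adjoint_apply_le {V W : Type*} [NormedAddCommGroup V] [InnerProductSpace ℂ V]
    [FiniteDimensional ℂ V] [NormedAddCommGroup W] [InnerProductSpace ℂ W]
    [FiniteDimensional ℂ W] {A : V →ₗ[ℂ] W} {c : ℝ} (hc : 0 ≤ c) (h : ∀ v, ‖A v‖ ≤ c * ‖v‖) (w : W) :
    ‖LinearMap.adjoint A w‖ ≤ c * ‖w‖ := by
  set v := LinearMap.adjoint A w
  rcases eq_or_ne v 0 with hv | hv
  · simpa [hv] using mul_nonneg hc (norm_nonneg w)
  · have h1 : ‖v‖ * ‖v‖ ≤ c * ‖v‖ * ‖w‖ := by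
      rw [← inner_self_eq_norm_mul_norm (𝕜 := ℂ)]
      have h2 : inner ℂ v v = inner ℂ (A v) w := (LinearMap.adjoint_inner_right A v w)
      rw [h2]
      exact (re_inner_le_norm _ _).trans (mul_le_mul_of_nonneg_right (h v) (norm_nonneg _))
    have : 0 < ‖v‖ := norm_pos_iff.2 hv
    nlinarith

section Completeness

variable {n : ℕ} {H : Type*} [TopologicalSpace H]
  {I : ModelWithCorners ℝ (EuclideanSpace ℝ (Fin n)) H}
  {M : Type*} [TopologicalSpace M] [ChartedSpace H M]
  {E₀ : Type*} [NormedAddCommGroup E₀] [NormedSpace ℂ E₀]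
  {E : M → Type*} [TopologicalSpace (TotalSpace E₀ E)]
  [∀ x, NormedAddCommGroup (E x)] [∀ x, InnerProductSpace ℂ (E x)]
  [FiberBundle E₀ E] [VectorBundle ℂ E₀ E] [VectorBundle ℝ E₀ E]
  {F₀ : Type*} [NormedAddCommGroup F₀] [NormedSpace ℂ F₀]
  {F : M → Type*} [TopologicalSpace (TotalSpace F₀ F)]
  [∀ x, NormedAddCommGroup (F x)] [∀ x, InnerProductSpace ℂ (F x)]
  [FiberBundle F₀ F] [VectorBundle ℂ F₀ F] [VectorBundle ℝ F₀ F]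
  [MeasurableSpace M] {μ : Measure M}

/-- This is continuity from above for the measure with density `g`, which is finite. -/
lemma tendsto_setLIntegral_of_antitone {α : Type*} [MeasurableSpace α] {ν : Measure α}
    {g : α → ℝ≥0∞} (hg : ∫⁻ x, g x ∂ν < ⊤) {S : ℕ → Set α} (hS : ∀ k, MeasurableSet (S k))
    (hanti : Antitone S) (hempty : ⋂ k, S k = ∅) :
    Filter.Tendsto (fun k => ∫⁻ x in S k, g x ∂ν) Filter.atTop (𝓝 0) := by
  have : IsFiniteMeasure (ν.withDensity g) := isFiniteMeasure_withDensity hg.ne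
  have h := tendsto_measure_iInter_atTop (μ := ν.withDensity g)
    (fun k => (hS k).nullMeasurableSet) hanti ⟨0, measure_ne_top _ _⟩
  rw [hempty, measure_empty] at h
  exact h.congr fun k => withDensity_apply _ (hS k)

lemma enorm_sub_smul_sq_le {α : Type*} {V : α → Type*} [∀ x, NormedAddCommGroup (V x)]
    [∀ x, InnerProductSpace ℂ (V x)] {f : α → ℝ} (hf : ∀ x, f x ∈ Icc (0 : ℝ) 1) {S : Set α}
    (hfS : ∀ x ∉ S, f x = 1) (u : ∀ x, V x) (x : α) :
    ‖u x - f x • u x‖ₑ ^ 2 ≤ S.indicator (fun x => ‖u x‖ₑ ^ 2) x := by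
  by_cases hx : x ∈ S
  · rw [indicator_of_mem hx]
    gcongr
    rw [enorm_le_iff_norm_le]
    have h1 : u x - f x • u x = (1 - f x) • u x := by rw [sub_smul, one_smul]
    rw [h1, norm_smul, Real.norm_of_nonneg (by linarith [(hf x).2])]
    exact mul_le_of_le_one_left (norm_nonneg _) (by linarith [(hf x).1])
  · simp [hfS x hx]

/-- A sequence of smooth compactly supported functions between `0` and `1` which exhausts the
manifold, in the sense that the `k`-th function is equal to `1` outside of `S k`. -/
structure IsCutoffSequence (χ : ℕ → C^∞⟮I, M; ℝ⟯) (S : ℕ → Set M) : Prop where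
  mem_Icc : ∀ k x, χ k x ∈ Icc (0 : ℝ) 1
  compact : ∀ k, ∃ K : Set M, IsCompact K ∧ ∀ x ∉ K, χ k x = 0
  measurable : ∀ k, MeasurableSet (S k)
  antitone : Antitone S
  iInter_eq : ⋂ k, S k = ∅
  eq_one : ∀ k, ∀ x ∉ S k, χ k x = 1

variable [BorelSpace M] [SecondCountableTopology M] [T2Space M] [IsManifold I ∞ M]
  [ContMDiffVectorBundle ∞ E₀ E I] [FiniteDimensional ℂ E₀]
  [ContMDiffVectorBundle ∞ F₀ F I] [FiniteDimensional ℂ F₀]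

omit [ContMDiffVectorBundle ∞ F₀ F I] [FiniteDimensional ℂ F₀] in
/-- The graph norm of the error made by multiplying an element of the domain by a cutoff. -/
lemma graphNorm_sub_cutoff_sq_le (hE : IsSmoothHermitian I E₀ E)
    {f : M → ℝ} (hf : ∀ x, f x ∈ Icc (0 : ℝ) 1) {S : Set M} (hS : MeasurableSet S)
    (hfS : ∀ x ∉ S, f x = 1) {B : ∀ x, E x →ₗ[ℂ] F x} {c : ℝ}
    (hc : ∀ x e, ‖B x e‖ ≤ c * ‖e‖) {u : ∀ x, E x} (hu : MemL2 E₀ μ u)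
    (w : ∀ x, F x) :
    l2Norm μ (u - fun x => f x • u x) ^ 2 +
      l2Norm μ (w - ((fun x => f x • w x) + fun x => B x (u x))) ^ 2 ≤
    ∫⁻ x in S, ‖u x‖ₑ ^ 2 ∂μ + (2 * ∫⁻ x in S, ‖w x‖ₑ ^ 2 ∂μ +
      2 * (ENNReal.ofReal c ^ 2 * ∫⁻ x, ‖u x‖ₑ ^ 2 ∂μ)) := by
  rw [l2Norm_sq, l2Norm_sq]
  refine add_le_add ?_ ?_
  · rw [← lintegral_indicator hS]
    exact lintegral_mono fun x => enorm_sub_smul_sq_le hf hfS u x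
  · have hB : ∀ x, ‖B x (u x)‖ₑ ≤ ENNReal.ofReal c * ‖u x‖ₑ := by
      intro x
      rw [← ofReal_norm, ← ofReal_norm, ← ENNReal.ofReal_mul' (norm_nonneg _)]
      exact ENNReal.ofReal_le_ofReal (hc x _)
    calc ∫⁻ x, ‖(w - ((fun x => f x • w x) + fun x => B x (u x))) x‖ₑ ^ 2 ∂μ
        ≤ ∫⁻ x, (2 * S.indicator (fun x => ‖w x‖ₑ ^ 2) x +
            2 * (ENNReal.ofReal c ^ 2 * ‖u x‖ₑ ^ 2)) ∂μ := by
          refine lintegral_mono fun x => ?_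
          have h1 : (w - ((fun x => f x • w x) + fun x => B x (u x))) x =
              (w x - f x • w x) + -(B x (u x)) := by
            simp only [Pi.sub_apply, Pi.add_apply]
            abel
          rw [h1]
          refine (enorm_add_sq_le _ _).trans ?_
          rw [enorm_neg]
          gcongr
          · exact enorm_sub_smul_sq_le hf hfS w x
          · rw [← mul_pow]
            exact pow_le_pow_left' (hB x) 2
      _ = _ := by
          rw [lintegral_add_right' _ ((((hu.1.enorm hE).pow_const 2).const_mul _).const_mul _),
            lintegral_const_mul' _ _ (by simp), lintegral_const_mul' _ _ (by simp),
            lintegral_const_mul' _ _ (by simp), lintegral_indicator hS]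

/-- The Hilbert space adjoint of a local operator is complete if there is a sequence of cutoffs
whose commutators with the operator have fibrewise adjoints tending to zero uniformly. -/
lemma isComplete_adjointGraph [IsLocallyFiniteMeasure μ] (hE : IsSmoothHermitian I E₀ E)
    (hF : IsSmoothHermitian I F₀ F)
    {T : SmoothSections I F₀ F →ₗ[ℂ] SmoothSections I E₀ E} (hT : IsLocal T)
    {χ : ℕ → C^∞⟮I, M; ℝ⟯} {S : ℕ → Set M} (hχ : IsCutoffSequence χ S)
    {B : ℕ → ∀ x, E x →ₗ[ℂ] F x}
    (hB : ∀ k, ∀ s : SmoothSections I E₀ E,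
      ∃ t : SmoothSections I F₀ F, ∀ x, B k x (s.1 x) = t.1 x)
    {c : ℕ → ℝ} (hc : ∀ k x e, ‖B k x e‖ ≤ c k * ‖e‖)
    (hc0 : Filter.Tendsto c Filter.atTop (𝓝 0))
    (hBT : ∀ k, ∀ (φ : SmoothSections I F₀ F) (x : M) (e : E x),
      inner ℂ (commutatorAt T (χ k) φ x) e + inner ℂ (φ.1 x) (B k x e) = 0) :
    IsComplete μ (adjointGraph μ T) := by
  rintro ⟨u, w⟩ hq ε hε
  obtain ⟨hu, hw, -⟩ := id hq
  dsimp only at hu hw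
  have hu' := (l2Norm_lt_top_iff _).1 hu.2
  have hw' := (l2Norm_lt_top_iff _).1 hw.2
  have ht : Filter.Tendsto (fun k => ∫⁻ x in S k, ‖u x‖ₑ ^ 2 ∂μ + (2 * ∫⁻ x in S k, ‖w x‖ₑ ^ 2 ∂μ +
      2 * (ENNReal.ofReal (c k) ^ 2 * ∫⁻ x, ‖u x‖ₑ ^ 2 ∂μ))) Filter.atTop (𝓝 0) := by
    have h1 := tendsto_setLIntegral_of_antitone hu' hχ.measurable hχ.antitone hχ.iInter_eq
    have h2 := tendsto_setLIntegral_of_antitone hw' hχ.measurable hχ.antitone hχ.iInter_eq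
    have h3 : Filter.Tendsto (fun k => ENNReal.ofReal (c k) ^ 2) Filter.atTop (𝓝 0) := by
      simpa using ENNReal.Tendsto.pow (n := 2) (ENNReal.tendsto_ofReal hc0)
    have h4 := ENNReal.Tendsto.mul_const h3 (b := ∫⁻ x, ‖u x‖ₑ ^ 2 ∂μ) (Or.inr hu'.ne)
    have h5 := ENNReal.Tendsto.const_mul h4 (a := 2) (Or.inr (by simp))
    have h6 := ENNReal.Tendsto.const_mul h2 (a := 2) (Or.inr (by simp))
    simpa using h1.add (h6.add h5)
  have hε2 : (0 : ℝ≥0∞) < ENNReal.ofReal ε ^ 2 := by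
    exact ENNReal.pow_pos (ENNReal.ofReal_pos.2 hε) 2
  obtain ⟨k, hk⟩ := ((tendsto_order.1 ht).2 _ hε2).exists
  -- The approximant is the pair `(χ_k u, χ_k w + B_k u)`.
  refine ⟨_, smul_mem_adjointGraph hE hF hT (c₀ := 1) (fun x => ?_) (hB k) (hc k) (hBT k) hq, ?_, ?_⟩
  · rw [abs_le]
    have := hχ.mem_Icc k x
    constructor <;> linarith [this.1, this.2]
  · obtain ⟨K, hK, h⟩ := hχ.compact k
    exact ⟨K, hK, fun x hx => by simp [h x hx]⟩
  · have h1 := (graphNorm_sub_cutoff_sq_le hE (hχ.mem_Icc k) (hχ.measurable k) (hχ.eq_one k)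
      (hc k) hu w).trans_lt hk
    have h2 := ENNReal.rpow_lt_rpow h1 (z := (1 / 2 : ℝ)) (by norm_num)
    refine lt_of_lt_of_eq h2 ?_
    rw [← ENNReal.rpow_natCast, ← ENNReal.rpow_mul]
    norm_num

/-- If there are cutoffs on whose differentials the symbol of `D` tends to zero uniformly, then `D`
and its formal adjoint are complete. -/
theorem isComplete_of_isCutoffSequence (hμ : IsSmoothMeasure I μ) (hE : IsSmoothHermitian I E₀ E)
    (hF : IsSmoothHermitian I F₀ F) {D : SmoothSections I E₀ E →ₗ[ℂ] SmoothSections I F₀ F}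
    (hD : IsFirstOrder D) {Ddag : SmoothSections I F₀ F →ₗ[ℂ] SmoothSections I E₀ E}
    (hDdag : IsFormalAdjoint μ D Ddag) {χ : ℕ → C^∞⟮I, M; ℝ⟯} {S : ℕ → Set M}
    (hχ : IsCutoffSequence χ S) {c : ℕ → ℝ} (hc₀ : ∀ k, 0 ≤ c k)
    (hc : ∀ k x e, ‖principalSymbol D x (mfderiv I 𝓘(ℝ, ℝ) (χ k) x) e‖ ≤ c k * ‖e‖)
    (hlim : Filter.Tendsto c Filter.atTop (𝓝 0)) :
    IsComplete μ (maxGraph μ Ddag) ∧ IsComplete μ (maxGraph μ D) := by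
  have : LocallyCompactSpace H := I.locallyCompactSpace
  have : LocallyCompactSpace M := ChartedSpace.locallyCompactSpace H M
  have := hμ.isLocallyFiniteMeasure
  have (x : M) : FiniteDimensional ℂ (E x) := finiteDimensional_fiber (E₀ := E₀) x
  have (x : M) : FiniteDimensional ℂ (F x) := finiteDimensional_fiber (E₀ := F₀) x
  have hskew := fun k => hDdag.inner_commutatorAt_add hμ hE hF hD (χ k)
  -- For `T = D†` the operator `B` is the symbol of `D` at `dχ_k`. For `T = D` it is minus the
  -- fibrewise adjoint of that symbol; by `hskew` this equals `[D†, χ_k]`, hence preserves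
  -- smoothness, and it obeys the same norm bound.
  refine ⟨isComplete_adjointGraph hE hF (hDdag.isLocal hμ hE hD) hχ
    (B := fun k x => symbolMap hD (χ k) x)
    (fun k s => ⟨commutatorSection D (χ k) s, fun x => symbolMap_apply hD (χ k) s x⟩)
    hc hlim fun k φ x e => ?_,
    isComplete_adjointGraph hF hE hD.isLocal hχ
    (B := fun k x => -LinearMap.adjoint (symbolMap hD (χ k) x))
    (fun k s => ⟨commutatorSection Ddag (χ k) s, fun x => ?_⟩)
    (fun k x e => ?_) hlim fun k φ x e => ?_⟩
  · obtain ⟨u, rfl⟩ := exists_section_eq (I := I) (E₀ := E₀) x e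
    rw [symbolMap_apply, ← inner_conj_symm, ← inner_conj_symm (φ.1 x), ← map_add, add_comm,
      hskew, map_zero]
  · refine ext_inner_left ℂ fun v => ?_
    obtain ⟨u, rfl⟩ := exists_section_eq (I := I) (E₀ := E₀) x v
    rw [LinearMap.neg_apply, inner_neg_right, LinearMap.adjoint_inner_right, symbolMap_apply,
      commutatorSection_apply]
    exact neg_eq_of_add_eq_zero_right (hskew k u s x)
  · rw [LinearMap.neg_apply, norm_neg]
    exact norm_adjoint_apply_le (hc₀ k) (fun v => hc k x v) e
  · rw [LinearMap.neg_apply, inner_neg_right, LinearMap.adjoint_inner_right, symbolMap_apply,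
      add_neg_cancel]

end Completeness

/-! ### Smoothing of Lipschitz functions on normed spaces -/

section Smoothing

open scoped NNReal Convolution

/-- Lipschitz functions can be approximated uniformly by smooth functions with the same Lipschitz
constant. -/
lemma exists_contDiff_lipschitzWith_approx {V : Type*} [NormedAddCommGroup V] [NormedSpace ℝ V]
    [FiniteDimensional ℝ V] {g : V → ℝ} {L : ℝ≥0} (hg : LipschitzWith L g) {ε : ℝ} (hε : 0 < ε) :
    ∃ f : V → ℝ, ContDiff ℝ ∞ f ∧ LipschitzWith L f ∧ ∀ x, |f x - g x| ≤ ε := by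
  borelize V
  let ν : Measure V := Measure.addHaar
  -- This gives `L δ ≤ ε`, with `L + 1` in place of `L` to allow `L = 0`.
  set δ : ℝ := ε / (L + 1)
  have hδ : 0 < δ := by positivity
  let φ : ContDiffBump (0 : V) := ⟨δ / 2, δ, half_pos hδ, half_lt_self hδ⟩
  let ψ := φ.normed ν
  have hψc : HasCompactSupport ψ := φ.hasCompactSupport_normed
  have hgl : LocallyIntegrable g ν := hg.continuous.locallyIntegrable
  have hconv : ConvolutionExists ψ g (ContinuousLinearMap.lsmul ℝ ℝ) ν :=
    hψc.convolutionExists_left _ φ.continuous_normed hgl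
  refine ⟨ψ ⋆[ContinuousLinearMap.lsmul ℝ ℝ, ν] g,
    hψc.contDiff_convolution_left _ φ.contDiff_normed hgl, ?_, fun x => ?_⟩
  -- Averaging translates against a probability density preserves the Lipschitz constant.
  · refine LipschitzWith.of_dist_le_mul fun x y => ?_
    rw [dist_eq_norm, convolution_def, convolution_def,
      ← integral_sub (hconv x).integrable (hconv y).integrable]
    calc ‖∫ t, (ContinuousLinearMap.lsmul ℝ ℝ (ψ t) (g (x - t)) -
            ContinuousLinearMap.lsmul ℝ ℝ (ψ t) (g (y - t))) ∂ν‖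
        ≤ ∫ t, ψ t * (L * dist x y) ∂ν := by
          refine norm_integral_le_of_norm_le (φ.integrable_normed.mul_const _)
            (Filter.Eventually.of_forall fun t => ?_)
          have h1 : dist (g (x - t)) (g (y - t)) ≤ L * dist x y := by
            simpa using hg.dist_le_mul (x - t) (y - t)
          rw [← map_sub, ContinuousLinearMap.lsmul_apply, norm_smul,
            Real.norm_of_nonneg (φ.nonneg_normed t), ← dist_eq_norm]
          exact mul_le_mul_of_nonneg_left h1 (φ.nonneg_normed t)
      _ = L * dist x y := by rw [integral_mul_const, φ.integral_normed, one_mul]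
  · rw [← Real.dist_eq]
    refine φ.dist_normed_convolution_le hg.continuous.aestronglyMeasurable fun y hy => ?_
    refine (hg.dist_le_mul y x).trans ?_
    have h1 : dist y x ≤ δ := (Metric.mem_ball.1 hy).le
    calc (L : ℝ) * dist y x ≤ (L + 1) * δ := by
          gcongr
          linarith
      _ = ε := mul_div_cancel₀ _ (by positivity)

/-- A function which is Lipschitz on a set with respect to some norm can be approximated there by a
smooth function whose derivative is bounded in terms of this norm. -/
lemma exists_contDiff_fderiv_le_approx {W V : Type*} [NormedAddCommGroup W] [NormedSpace ℝ W]
    [NormedAddCommGroup V] [NormedSpace ℝ V] [FiniteDimensional ℝ V] (e : W →L[ℝ] V)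
    (he : Function.Injective e)
    {g : W → ℝ} {S : Set W} {L : ℝ≥0} (hg : ∀ y ∈ S, ∀ z ∈ S, |g y - g z| ≤ L * ‖e (y - z)‖)
    {ε : ℝ} (hε : 0 < ε) :
    ∃ f : W → ℝ, ContDiff ℝ ∞ f ∧ (∀ y v, |fderiv ℝ f y v| ≤ L * ‖e v‖) ∧
      ∀ y ∈ S, |f y - g y| ≤ ε := by
  have hinv : ∀ y, Function.invFun e (e y) = y := Function.leftInverse_invFun he
  -- The function is moved to `V`, extended from `e '' S` to all of `V`, smoothed there and pulled
  -- back along `e`. The extension supplies the values outside `S` that mollification needs, in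
  -- particular beyond the boundary of a chart.
  have hL : LipschitzOnWith L (g ∘ Function.invFun e) (e '' S) := by
    refine LipschitzOnWith.of_dist_le_mul ?_
    rintro _ ⟨y, hy, rfl⟩ _ ⟨z, hz, rfl⟩
    simpa [hinv, Real.dist_eq, dist_eq_norm] using hg y hy z hz
  obtain ⟨G, hG, hGS⟩ := hL.extend_real
  obtain ⟨f, hf, hfL, hfG⟩ := exists_contDiff_lipschitzWith_approx hG hε
  refine ⟨f ∘ e, hf.comp e.contDiff, fun y v => ?_, fun y hy => ?_⟩
  · have h1 : HasFDerivAt (f ∘ e) ((fderiv ℝ f (e y)) ∘L e) y :=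
      ((hf.differentiable (by simp)) (e y)).hasFDerivAt.comp y e.hasFDerivAt
    rw [h1.fderiv, ContinuousLinearMap.comp_apply, ← Real.norm_eq_abs]
    exact (ContinuousLinearMap.le_opNorm _ _).trans
      (mul_le_mul_of_nonneg_right (norm_fderiv_le_of_lipschitz ℝ hfL) (norm_nonneg _))
  · have h1 := hGS (mem_image_of_mem e hy)
    have h2 := hfG (e y)
    rw [← h1] at h2
    simpa [hinv] using h2

end Smoothing

/-! ### Riemannian distances in charts -/

section ChartEstimates

open scoped NNReal

variable {n : ℕ} {H : Type*} [TopologicalSpace H]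
  {I : ModelWithCorners ℝ (EuclideanSpace ℝ (Fin n)) H}
  {M : Type*} [MetricSpace M] [ChartedSpace H M] [IsManifold I ∞ M]
  [RiemannianBundle (fun x : M => TangentSpace I x)]

/-- The inverse of the trivialization of the tangent bundle around `x₀`, at `x₀`. The metric of
`T_{x₀} M` read in the chart is the norm of this map. -/
def tangentSymm (I : ModelWithCorners ℝ (EuclideanSpace ℝ (Fin n)) H) [IsManifold I ∞ M] (x₀ : M) :
    EuclideanSpace ℝ (Fin n) →L[ℝ] TangentSpace I x₀ :=
  (trivializationAt (EuclideanSpace ℝ (Fin n)) (TangentSpace I) x₀).symmL ℝ x₀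

omit [RiemannianBundle (fun x : M => TangentSpace I x)] in
lemma tangentSymm_injective (x₀ : M) : Function.Injective (tangentSymm I x₀) := by
  intro v w h
  have hx := FiberBundle.mem_baseSet_trivializationAt' (F := EuclideanSpace ℝ (Fin n))
    (E := (TangentSpace I : M → Type _)) x₀
  have key := fun v => (trivializationAt (EuclideanSpace ℝ (Fin n))
    (TangentSpace I) x₀).continuousLinearMapAt_symmL (R := ℝ) hx v
  rw [← key v, ← key w]
  exact congrArg _ h

omit [IsManifold I ∞ M] [RiemannianBundle (fun x : M => TangentSpace I x)] in
lemma finiteDimensional_tangentSpace (x₀ : M) : FiniteDimensional ℝ (TangentSpace I x₀) :=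
  inferInstanceAs (FiniteDimensional ℝ (EuclideanSpace ℝ (Fin n)))

variable [IsContMDiffRiemannianBundle I ∞ (EuclideanSpace ℝ (Fin n))
    (fun x : M => TangentSpace I x)]

lemma isContinuousRiemannianBundle_tangentSpace :
    IsContinuousRiemannianBundle (EuclideanSpace ℝ (Fin n)) (fun x : M => TangentSpace I x) := by
  obtain ⟨g, hg, h⟩ := IsContMDiffRiemannianBundle.exists_contMDiff (IB := I) (n := ∞)
    (F := EuclideanSpace ℝ (Fin n)) (E := fun x : M => TangentSpace I x)
  exact ⟨g, hg.continuous, h⟩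

/-- By continuity of the metric, comparing `T_x M` with `T_{x₀} M` through the chart costs a factor
close to `1`; the constant `2` stands for any number above `1`. The next lemma is the reverse
comparison. -/
lemma eventually_norm_tangentSymm_mfderiv_le (x₀ : M) :
    ∀ᶠ x in 𝓝 x₀, ∀ v : TangentSpace I x,
      ‖tangentSymm I x₀ (mfderiv I 𝓘(ℝ, EuclideanSpace ℝ (Fin n)) (extChartAt I x₀) x v)‖
        ≤ 2 * ‖v‖ := by
  have := isContinuousRiemannianBundle_tangentSpace (I := I) (M := M)
  filter_upwards [eventually_norm_symmL_trivializationAt_self_comp_lt (EuclideanSpace ℝ (Fin n))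
    (fun x : M => TangentSpace I x) x₀ one_lt_two, chart_source_mem_nhds H x₀] with x hx hxs v
  have h := ContinuousLinearMap.le_of_opNorm_le _ hx.le v
  rw [TangentBundle.continuousLinearMapAt_trivializationAt hxs] at h
  exact h

lemma eventually_norm_mfderivWithin_symm_le (x₀ : M) :
    ∀ᶠ y in 𝓝[range I] (extChartAt I x₀ x₀), ∀ v : EuclideanSpace ℝ (Fin n),
      ‖(mfderivWithin 𝓘(ℝ, EuclideanSpace ℝ (Fin n)) I (extChartAt I x₀).symm (range I) y v :
        TangentSpace I ((extChartAt I x₀).symm y))‖ ≤ 2 * ‖tangentSymm I x₀ v‖ := by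
  have := isContinuousRiemannianBundle_tangentSpace (I := I) (M := M)
  have h1 := eventually_norm_symmL_trivializationAt_comp_self_lt (EuclideanSpace ℝ (Fin n))
    (fun x : M => TangentSpace I x) x₀ one_lt_two
  have hc : Filter.Tendsto (extChartAt I x₀).symm (𝓝[range I] (extChartAt I x₀ x₀)) (𝓝 x₀) := by
    have := continuousAt_extChartAt_symm (I := I) x₀
    rw [ContinuousAt, extChartAt_to_inv] at this
    exact this.mono_left nhdsWithin_le_nhds
  filter_upwards [hc.eventually h1, extChartAt_target_mem_nhdsWithin x₀] with y hy hyt v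
  set x := (extChartAt I x₀).symm y with hx
  have hxs : x ∈ (chartAt H x₀).source := by
    rw [← extChartAt_source (I := I)]
    exact (extChartAt I x₀).map_target hyt
  have hx₀ := FiberBundle.mem_baseSet_trivializationAt' (F := EuclideanSpace ℝ (Fin n))
    (E := (TangentSpace I : M → Type _)) x₀
  have h2 := ContinuousLinearMap.le_of_opNorm_le _ hy.le (tangentSymm I x₀ v)
  rw [ContinuousLinearMap.comp_apply, tangentSymm, Trivialization.continuousLinearMapAt_symmL _ hx₀]
    at h2
  -- The point `x` itself depends on `y`, so the equality between `y` and the chart image of `x` is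
  -- used through a free variable.
  have h3 : ∀ y', y' = extChartAt I x₀ x →
      (trivializationAt (EuclideanSpace ℝ (Fin n)) (TangentSpace I) x₀).symmL ℝ x v =
      (mfderivWithin 𝓘(ℝ, EuclideanSpace ℝ (Fin n)) I (extChartAt I x₀).symm (range I) y' v :) := by
    rintro _ rfl
    rw [TangentBundle.symmL_trivializationAt hxs]
    rfl
  have h4 := h3 y ((extChartAt I x₀).right_inv hyt).symm
  rw [h4] at h2
  exact h2

variable [IsRiemannianManifold I M]

/-- In a small ball of the chart around `x₀`, the Riemannian distance is bounded by twice the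
distance given by the metric at `x₀`. -/
lemma exists_ball_dist_extChartAt_symm_le (x₀ : M) :
    ∃ r > 0, Metric.ball (extChartAt I x₀ x₀) r ∩ range I ⊆ (extChartAt I x₀).target ∧
      ∀ y ∈ Metric.ball (extChartAt I x₀ x₀) r ∩ range I,
      ∀ z ∈ Metric.ball (extChartAt I x₀ x₀) r ∩ range I,
        dist ((extChartAt I x₀).symm y) ((extChartAt I x₀).symm z) ≤
          2 * ‖tangentSymm I x₀ (y - z)‖ := by
  obtain ⟨r, hr, hsub⟩ := Metric.mem_nhdsWithin_iff.1
    (Filter.inter_mem (extChartAt_target_mem_nhdsWithin (I := I) x₀)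
      (eventually_norm_mfderivWithin_symm_le (I := I) x₀))
  refine ⟨r, hr, fun y hy => (hsub hy).1, fun y hy z hz => ?_⟩
  -- The straight segment stays in the chart because the ball and `range I` are convex; its length
  -- bounds the distance from above.
  let η : ℝ → EuclideanSpace ℝ (Fin n) := AffineMap.lineMap y z
  have hη : ∀ t ∈ Icc (0 : ℝ) 1, η t ∈ Metric.ball (extChartAt I x₀ x₀) r ∩ range I := by
    intro t ht
    have hseg := ((convex_ball (extChartAt I x₀ x₀) r).inter I.convex_range).segment_subset hy hz
    rw [segment_eq_image_lineMap] at hseg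
    exact hseg (mem_image_of_mem _ ht)
  have hηd : ∀ t, HasDerivAt η (z - y) t := fun t => AffineMap.hasDerivAt_lineMap
  have hηs : ContMDiffOn 𝓘(ℝ, ℝ) 𝓘(ℝ, EuclideanSpace ℝ (Fin n)) 1 η (Icc 0 1) := by
    rw [contMDiffOn_iff_contDiffOn]
    exact (ContinuousAffineMap.lineMap (R := ℝ) y z).contDiff.contDiffOn
  have hle : edist ((extChartAt I x₀).symm y) ((extChartAt I x₀).symm z) ≤
      pathELength I ((extChartAt I x₀).symm ∘ η) 0 1 := by
    rw [IsRiemannianManifold.out (I := I)]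
    refine riemannianEDist_le_pathELength ?_ (by simp [η]) (by simp [η]) zero_le_one
    exact (contMDiffOn_extChartAt_symm x₀).comp hηs fun t ht => (hsub (hη t ht)).1
  have hlen : pathELength I ((extChartAt I x₀).symm ∘ η) 0 1 ≤
      ENNReal.ofReal (2 * ‖tangentSymm I x₀ (y - z)‖) := by
    rw [pathELength_eq_lintegral_mfderivWithin_Icc]
    calc _ ≤ ∫⁻ t in Icc (0 : ℝ) 1, ENNReal.ofReal (2 * ‖tangentSymm I x₀ (y - z)‖) := by
          refine setLIntegral_mono' measurableSet_Icc fun t ht => ?_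
          have hu : UniqueMDiffWithinAt 𝓘(ℝ, ℝ) (Icc (0 : ℝ) 1) t :=
            (uniqueDiffOn_Icc zero_lt_one t ht).uniqueMDiffWithinAt
          have h1 : HasMFDerivWithinAt 𝓘(ℝ, ℝ) 𝓘(ℝ, EuclideanSpace ℝ (Fin n)) η (Icc 0 1) t
              (ContinuousLinearMap.toSpanSingleton ℝ (z - y)) :=
            (hηd t).hasFDerivAt.hasMFDerivAt.hasMFDerivWithinAt
          have h2 := (mdifferentiableWithinAt_extChartAt_symm (I := I)
            (hsub (hη t ht)).1).hasMFDerivWithinAt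
          have h3 := h2.comp t h1 fun s hs => (hη s hs).2
          have h4 : mfderivWithin 𝓘(ℝ, ℝ) I ((extChartAt I x₀).symm ∘ η) (Icc 0 1) t (1 : ℝ) =
              mfderivWithin 𝓘(ℝ, EuclideanSpace ℝ (Fin n)) I (extChartAt I x₀).symm (range I)
                (η t) (z - y) := by
            rw [h3.mfderivWithin hu]
            exact congrArg (mfderivWithin 𝓘(ℝ, EuclideanSpace ℝ (Fin n)) I (extChartAt I x₀).symm
              (range I) (η t)) (one_smul ℝ (z - y))
          rw [← ofReal_norm]
          refine ENNReal.ofReal_le_ofReal ?_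
          have h5 := (hsub (hη t ht)).2 (z - y)
          have h6 : ‖tangentSymm I x₀ (z - y)‖ = ‖tangentSymm I x₀ (y - z)‖ := by
            rw [← norm_neg, ← map_neg, neg_sub]
          rw [h6] at h5
          have h7 := congrArg
            (fun w : TangentSpace I ((extChartAt I x₀).symm (η t)) => ‖w‖) h4
          exact (le_of_eq h7).trans h5
      _ = ENNReal.ofReal (2 * ‖tangentSymm I x₀ (y - z)‖) := by simp
  rw [edist_dist] at hle
  exact (ENNReal.ofReal_le_ofReal_iff (by positivity)).1 (hle.trans hlen)

end ChartEstimates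

/-! ### Smoothing of Lipschitz functions on Riemannian manifolds -/

section RiemannianSmoothing

open scoped NNReal

variable {n : ℕ} {H : Type*} [TopologicalSpace H]
  {I : ModelWithCorners ℝ (EuclideanSpace ℝ (Fin n)) H}
  {M : Type*} [MetricSpace M] [ChartedSpace H M]

lemma hasMFDerivAt_sum_mul {ι : Type*} (J : Finset ι) {ρ f : ι → M → ℝ} {x : M}
    {ρ' f' : ι → TangentSpace I x →L[ℝ] ℝ}
    (hρ : ∀ j ∈ J, HasMFDerivAt I 𝓘(ℝ, ℝ) (ρ j) x (ρ' j))
    (hf : ∀ j ∈ J, HasMFDerivAt I 𝓘(ℝ, ℝ) (f j) x (f' j)) :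
    HasMFDerivAt I 𝓘(ℝ, ℝ) (fun y => ∑ j ∈ J, ρ j y * f j y) x
      (∑ j ∈ J, (ρ j x • f' j + f j x • ρ' j) : TangentSpace I x →L[ℝ] ℝ) := by
  refine ⟨tendsto_finsetSum J fun j hj => (hρ j hj).1.mul (hf j hj).1, ?_⟩
  have h := HasFDerivWithinAt.fun_sum (u := J) fun j hj => (hρ j hj).2.mul (hf j hj).2
  refine h.congr_fderiv (Finset.sum_congr rfl fun j hj => ?_)
  have hv : ∀ g : M → ℝ, writtenInExtChartAt I 𝓘(ℝ, ℝ) x g (extChartAt I x x) = g x := by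
    intro g
    change g ((extChartAt I x).symm (extChartAt I x x)) = g x
    rw [extChartAt_to_inv]
  rw [hv, hv]
  rfl

variable [IsManifold I ∞ M]

/-- Differentiability of `F` is only required within the chart target, so that boundary points are
covered. -/
lemma exists_hasMFDerivAt_comp_extChartAt {x₀ x : M} (hx : x ∈ (chartAt H x₀).source)
    {f : M → ℝ} {F : EuclideanSpace ℝ (Fin n) → ℝ} {F' : EuclideanSpace ℝ (Fin n) →L[ℝ] ℝ}
    (hF : HasFDerivWithinAt F F' (extChartAt I x₀).target (extChartAt I x₀ x))
    (hf : ∀ y ∈ (chartAt H x₀).source, f y = F (extChartAt I x₀ y)) :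
    ∃ ℓ : TangentSpace I x →L[ℝ] ℝ, HasMFDerivAt I 𝓘(ℝ, ℝ) f x ℓ ∧
      ∀ v, ℓ v = F' (mfderiv I 𝓘(ℝ, EuclideanSpace ℝ (Fin n)) (extChartAt I x₀) x v) := by
  have hs : (chartAt H x₀).source ∈ 𝓝 x := (chartAt H x₀).open_source.mem_nhds hx
  have h1 : HasMFDerivWithinAt I 𝓘(ℝ, EuclideanSpace ℝ (Fin n)) (extChartAt I x₀)
      (chartAt H x₀).source x
      (mfderiv I 𝓘(ℝ, EuclideanSpace ℝ (Fin n)) (extChartAt I x₀) x) :=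
    (mdifferentiableAt_extChartAt hx).hasMFDerivAt.hasMFDerivWithinAt
  have h2 := hF.hasMFDerivWithinAt.comp x h1 fun y hy =>
    (extChartAt I x₀).map_source (by rwa [extChartAt_source])
  have h3 := h2.hasMFDerivAt hs
  refine ⟨_, h3.congr_of_eventuallyEq ?_, fun v => rfl⟩
  filter_upwards [hs] with y hy using hf y hy

variable [RiemannianBundle (fun x : M => TangentSpace I x)]
  [IsContMDiffRiemannianBundle I ∞ (EuclideanSpace ℝ (Fin n)) (fun x : M => TangentSpace I x)]

/-- The differential of a smooth function is locally bounded. -/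
lemma exists_eventually_hasMFDerivAt_le (f : C^∞⟮I, M; ℝ⟯) (x₀ : M) :
    ∃ c : ℝ, 0 ≤ c ∧ ∀ᶠ x in 𝓝 x₀, ∀ ℓ : TangentSpace I x →L[ℝ] ℝ,
      HasMFDerivAt I 𝓘(ℝ, ℝ) f x ℓ → ∀ v, |ℓ v| ≤ c * ‖v‖ := by
  have hx₀ := FiberBundle.mem_baseSet_trivializationAt' (F := EuclideanSpace ℝ (Fin n))
    (E := (TangentSpace I : M → Type _)) x₀
  -- A left inverse of `tangentSymm I x₀`, which converts bounds in the norm of `T_{x₀} M` into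
  -- Euclidean ones.
  let A : TangentSpace I x₀ →L[ℝ] EuclideanSpace ℝ (Fin n) := (trivializationAt
    (EuclideanSpace ℝ (Fin n)) (TangentSpace I) x₀).continuousLinearMapAt ℝ x₀
  have hA : ∀ w, A (tangentSymm I x₀ w) = w := fun w =>
    Trivialization.continuousLinearMapAt_symmL _ hx₀ w
  let F : EuclideanSpace ℝ (Fin n) → ℝ := f ∘ (extChartAt I x₀).symm
  have hF : ContDiffOn ℝ ∞ F (extChartAt I x₀).target :=
    contMDiffOn_iff_contDiffOn.1 (f.contMDiff.comp_contMDiffOn (contMDiffOn_extChartAt_symm x₀))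
  have hFc : ContinuousOn (fun y => ‖fderivWithin ℝ F (extChartAt I x₀).target y‖)
      (extChartAt I x₀).target :=
    (hF.continuousOn_fderivWithin (uniqueDiffOn_extChartAt_target x₀) (by simp)).norm
  set a := ‖fderivWithin ℝ F (extChartAt I x₀).target (extChartAt I x₀ x₀)‖ + 1
  have hev : ∀ᶠ x in 𝓝 x₀,
      ‖fderivWithin ℝ F (extChartAt I x₀).target (extChartAt I x₀ x)‖ < a := by
    have h1 : Filter.Tendsto (extChartAt I x₀) (𝓝 x₀)
        (𝓝[(extChartAt I x₀).target] (extChartAt I x₀ x₀)) := by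
      refine tendsto_nhdsWithin_iff.2 ⟨continuousAt_extChartAt x₀, ?_⟩
      filter_upwards [extChartAt_source_mem_nhds (I := I) x₀] with x hx
      exact (extChartAt I x₀).map_source hx
    exact h1.eventually ((hFc _ (mem_extChartAt_target x₀)).eventually (gt_mem_nhds (lt_add_one _)))
  refine ⟨a * (‖A‖ * 2), by positivity, ?_⟩
  filter_upwards [hev, chart_source_mem_nhds H x₀,
    eventually_norm_tangentSymm_mfderiv_le (I := I) x₀] with x hxa hxs hxe ℓ hℓ v
  have hxt : extChartAt I x₀ x ∈ (extChartAt I x₀).target :=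
    (extChartAt I x₀).map_source (by rwa [extChartAt_source])
  obtain ⟨ℓ', hℓ', h⟩ := exists_hasMFDerivAt_comp_extChartAt (f := f) hxs
    ((hF.differentiableOn (by simp) _ hxt).hasFDerivWithinAt) fun y hy => by
      simp only [F, Function.comp_apply]
      rw [(extChartAt I x₀).left_inv (by rwa [extChartAt_source])]
  obtain rfl : ℓ = ℓ' := hasMFDerivAt_unique hℓ hℓ'
  rw [h, ← Real.norm_eq_abs]
  set w : EuclideanSpace ℝ (Fin n) :=
    mfderiv I 𝓘(ℝ, EuclideanSpace ℝ (Fin n)) (extChartAt I x₀) x v with hw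
  have h1 : ‖w‖ ≤ ‖A‖ * (2 * ‖v‖) := by
    rw [← hA w]
    exact (A.le_opNorm _).trans (mul_le_mul_of_nonneg_left (hxe v) (norm_nonneg _))
  calc _ ≤ ‖fderivWithin ℝ F (extChartAt I x₀).target (extChartAt I x₀ x)‖ * ‖w‖ :=
        ContinuousLinearMap.le_opNorm _ _
    _ ≤ a * (‖A‖ * (2 * ‖v‖)) := by gcongr
    _ = a * (‖A‖ * 2) * ‖v‖ := by ring

variable [IsRiemannianManifold I M]

/-- Local smoothing of a Lipschitz function. -/
lemma exists_local_smooth_approx {g : M → ℝ} (hg : LipschitzWith 1 g) (x₀ : M) :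
    ∃ V ∈ 𝓝 x₀, ∀ ε > 0, ∃ f : M → ℝ, ∀ x ∈ V, |f x - g x| ≤ ε ∧
      ContMDiffAt I 𝓘(ℝ, ℝ) ∞ f x ∧ ∃ ℓ : TangentSpace I x →L[ℝ] ℝ,
        HasMFDerivAt I 𝓘(ℝ, ℝ) f x ℓ ∧ ∀ v, |ℓ v| ≤ 4 * ‖v‖ := by
  obtain ⟨r, hr, hsub, hdist⟩ := exists_ball_dist_extChartAt_symm_le (I := I) x₀
  have := finiteDimensional_tangentSpace (I := I) x₀
  set φ := extChartAt I x₀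
  have hball : φ ⁻¹' Metric.ball (φ x₀) r ∈ 𝓝 x₀ :=
    (continuousAt_extChartAt x₀).preimage_mem_nhds (Metric.ball_mem_nhds _ hr)
  -- The neighbourhood is fixed before `ε`: in the gluing, `ε` depends on a partition of unity
  -- subordinate to these neighbourhoods.
  refine ⟨_, Filter.inter_mem (Filter.inter_mem hball (chart_source_mem_nhds H x₀))
    (eventually_norm_tangentSymm_mfderiv_le (I := I) x₀), fun ε hε => ?_⟩
  obtain ⟨F, hF, hF', hFg⟩ := exists_contDiff_fderiv_le_approx (tangentSymm I x₀)
    (tangentSymm_injective x₀) (g := g ∘ φ.symm) (S := Metric.ball (φ x₀) r ∩ range I) (L := 2)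
    (fun y hy z hz => by
      have h := (hg.dist_le_mul (φ.symm y) (φ.symm z)).trans
        (mul_le_mul_of_nonneg_left (hdist y hy z hz) (by simp))
      simpa [Real.dist_eq] using h) hε
  refine ⟨F ∘ φ, fun x hx => ?_⟩
  obtain ⟨⟨hxb, hxs⟩, hxe⟩ := hx
  have hxs' : x ∈ φ.source := by rwa [extChartAt_source]
  refine ⟨?_, ?_, ?_⟩
  · have h := hFg (φ x) ⟨hxb, extChartAt_target_subset_range x₀ (φ.map_source hxs')⟩
    simpa [φ.left_inv hxs'] using h
  · exact hF.contMDiff.contMDiffAt.comp x (contMDiffAt_extChartAt' hxs)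
  · obtain ⟨ℓ, hℓ, h⟩ := exists_hasMFDerivAt_comp_extChartAt (I := I) (f := F ∘ φ) (F := F) hxs
      ((hF.differentiable (by simp) (φ x)).hasFDerivAt.hasFDerivWithinAt) fun y hy => rfl
    refine ⟨ℓ, hℓ, fun v => ?_⟩
    rw [h]
    -- One factor `2` comes from comparing the distance with the norm at `x₀`, the other from the
    -- differential of the chart.
    calc _ ≤ 2 * ‖tangentSymm I x₀ _‖ := hF' _ _
      _ ≤ 2 * (2 * ‖v‖) := mul_le_mul_of_nonneg_left (hxe v) (by simp)
      _ = 4 * ‖v‖ := by ring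

end RiemannianSmoothing

/-! ### Gluing local approximations with a partition of unity -/

section Gluing

variable {n : ℕ} {H : Type*} [TopologicalSpace H]
  {I : ModelWithCorners ℝ (EuclideanSpace ℝ (Fin n)) H}
  {M : Type*} [MetricSpace M] [ChartedSpace H M] [IsManifold I ∞ M]
  [RiemannianBundle (fun x : M => TangentSpace I x)]
  [IsContMDiffRiemannianBundle I ∞ (EuclideanSpace ℝ (Fin n)) (fun x : M => TangentSpace I x)]

/-- On a compact set, the sum of the norms of the differentials of a partition of unity is
bounded. -/
lemma exists_sum_abs_mfderiv_le {ι : Type*} (ρ : SmoothPartitionOfUnity ι I M univ) {K : Set M}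
    (hK : IsCompact K) :
    ∃ c : ℝ, 0 ≤ c ∧ ∀ x ∈ K, ∀ v : TangentSpace I x,
      ∑ j ∈ ρ.fintsupport x, |(mfderiv I 𝓘(ℝ, ℝ) (ρ j) x v : ℝ)| ≤ c * ‖v‖ := by
  refine hK.induction_on ⟨0, le_rfl, by simp⟩ ?_ ?_ fun x₀ _ => ?_
  · rintro s t hst ⟨c, hc, h⟩
    exact ⟨c, hc, fun x hx => h x (hst hx)⟩
  · rintro s t ⟨c, hc, h⟩ ⟨c', hc', h'⟩
    refine ⟨max c c', hc.trans (le_max_left _ _), ?_⟩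
    rintro x (hx | hx) v
    · exact (h x hx v).trans (by gcongr; exact le_max_left _ _)
    · exact (h' x hx v).trans (by gcongr; exact le_max_right _ _)
  · choose c hc h using fun j => exists_eventually_hasMFDerivAt_le (ρ j) x₀
    -- Near `x₀` only the finitely many indices in `ρ.fintsupport x₀` contribute.
    have hev := (ρ.fintsupport x₀).eventually_all.2 fun j _ => h j
    refine ⟨_, mem_nhdsWithin_of_mem_nhds (hev.and (ρ.eventually_fintsupport_subset x₀)),
      ∑ j ∈ ρ.fintsupport x₀, c j, Finset.sum_nonneg fun j _ => hc j, fun x hx v => ?_⟩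
    obtain ⟨hx, hsub⟩ := hx
    calc ∑ j ∈ ρ.fintsupport x, |(mfderiv I 𝓘(ℝ, ℝ) (ρ j) x v : ℝ)|
        ≤ ∑ j ∈ ρ.fintsupport x₀, |(mfderiv I 𝓘(ℝ, ℝ) (ρ j) x v : ℝ)| :=
          Finset.sum_le_sum_of_subset_of_nonneg hsub fun _ _ _ => abs_nonneg _
      _ ≤ ∑ j ∈ ρ.fintsupport x₀, c j * ‖v‖ := by
          refine Finset.sum_le_sum fun j hj => ?_
          exact hx j hj _ (((ρ j).contMDiff.mdifferentiableAt (by simp)).hasMFDerivAt) v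
      _ = (∑ j ∈ ρ.fintsupport x₀, c j) * ‖v‖ := (Finset.sum_mul _ _ _).symm

variable [IsRiemannianManifold I M] [SecondCountableTopology M]

/-- A Lipschitz function on a Riemannian manifold can be approximated uniformly by a smooth function
with bounded differential. -/
theorem exists_smooth_approx_of_lipschitzWith {g : M → ℝ} (hg : LipschitzWith 1 g) :
    ∃ f : C^∞⟮I, M; ℝ⟯, (∀ x, |f x - g x| ≤ 1) ∧
      ∀ x, ∃ ℓ : TangentSpace I x →L[ℝ] ℝ,
        HasMFDerivAt I 𝓘(ℝ, ℝ) f x ℓ ∧ ∀ v, |ℓ v| ≤ 5 * ‖v‖ := by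
  have : LocallyCompactSpace H := I.locallyCompactSpace
  have : LocallyCompactSpace M := ChartedSpace.locallyCompactSpace H M
  choose V hV hloc using exists_local_smooth_approx (I := I) hg
  choose K hK hKn using fun x : M => exists_compact_mem_nhds x
  obtain ⟨ρ, hρ⟩ := SmoothPartitionOfUnity.exists_isSubordinate I isClosed_univ
    (fun x => interior (V x ∩ K x)) (fun _ => isOpen_interior) fun x _ =>
      mem_iUnion.2 ⟨x, mem_interior_iff_mem_nhds.2 (Filter.inter_mem (hV x) (hKn x))⟩
  choose c hc hcK using fun j => exists_sum_abs_mfderiv_le ρ (hK j)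
  -- The accuracy on the `j`-th patch is tuned to the bound `c j` for the differentials of the whole
  -- partition on `K j`, so that the terms `(f j - g) dρ_j` add at most `‖v‖` to the differential.
  choose f hf using fun j => hloc j (1 / (c j + 1)) (by have := hc j; positivity)
  have hρV : ∀ j, ∀ x ∈ tsupport (ρ j), x ∈ V j ∧ x ∈ K j := fun j x hx => by
    have h : x ∈ V j ∩ K j := interior_subset (hρ j hx)
    exact h
  have hsmooth : ContMDiff I 𝓘(ℝ, ℝ) ∞ fun x => ∑ᶠ j, ρ j x • f j x :=
    ρ.contMDiff_finsum_smul fun j x hx => (hf j x (hρV j x hx).1).2.1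
  have hsum : ∀ x₀ x, ρ.finsupport x ⊆ ρ.fintsupport x₀ → ∀ h : M → M → ℝ,
      ∑ᶠ j, ρ j x • h j x = ∑ j ∈ ρ.fintsupport x₀, ρ j x * h j x := by
    intro x₀ x hx h
    refine finsum_eq_sum_of_support_subset _ fun j hj => hx ((ρ.mem_finsupport x).2 ?_)
    exact fun h0 => hj (by simp [h0])
  have hone : ∀ x₀ x, ρ.finsupport x ⊆ ρ.fintsupport x₀ → ∑ j ∈ ρ.fintsupport x₀, ρ j x = 1 :=
    fun x₀ x hx => ρ.sum_finsupport' x (mem_univ x) hx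
  have hself : ∀ x, ρ.finsupport x ⊆ ρ.fintsupport x := fun x => ρ.finsupport_subset_fintsupport x
  have hsub : ∀ x₀ x, ρ.finsupport x ⊆ ρ.fintsupport x₀ → ∀ a : ℝ,
      (∑ᶠ j, ρ j x • f j x) - a = ∑ j ∈ ρ.fintsupport x₀, ρ j x * (f j x - a) := by
    intro x₀ x hx a
    rw [hsum x₀ x hx f]
    simp_rw [mul_sub]
    rw [Finset.sum_sub_distrib, ← Finset.sum_mul, hone x₀ x hx, one_mul]
  have hε : ∀ j, 1 / (c j + 1) ≤ 1 := fun j => by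
    rw [div_le_one (by linarith [hc j])]
    linarith [hc j]
  refine ⟨⟨_, hsmooth⟩, fun x => ?_, fun x => ?_⟩
  · change |(∑ᶠ j, ρ j x • f j x) - g x| ≤ 1
    rw [hsub x x (hself x), ← hone x x (hself x)]
    refine (Finset.abs_sum_le_sum_abs _ _).trans (Finset.sum_le_sum fun j hj => ?_)
    rw [abs_mul, abs_of_nonneg (ρ.nonneg j x)]
    refine mul_le_of_le_one_right (ρ.nonneg j x) (le_trans ?_ (hε j))
    exact (hf j x (hρV j x ((ρ.mem_fintsupport_iff x j).1 hj)).1).1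
  · set J := ρ.fintsupport x with hJ
    have hmem : ∀ j ∈ J, x ∈ V j ∧ x ∈ K j := fun j hj =>
      hρV j x ((ρ.mem_fintsupport_iff x j).1 hj)
    choose! ℓ hℓ hℓv using fun j (hj : j ∈ J) => (hf j x (hmem j hj).1).2.2
    let dρ : M → TangentSpace I x →L[ℝ] ℝ := fun j => mfderiv I 𝓘(ℝ, ℝ) (ρ j) x
    have hdρ : ∀ j ∈ J, HasMFDerivAt I 𝓘(ℝ, ℝ) (ρ j) x (dρ j) := fun j _ =>
      ((ρ j).contMDiff.mdifferentiableAt (by simp)).hasMFDerivAt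
    -- Since `g` need not be differentiable, it is frozen at its value at `x`. Near `x` the glued
    -- function minus `g x` is `∑ ρ_j (f_j - g x)`, whose differential at `x` is `∑ ρ_j df_j + ∑
    -- (f_j - g)(x) dρ_j`; the two sums are bounded by `4` and `1`.
    have hℓ' : ∀ j ∈ J, HasMFDerivAt I 𝓘(ℝ, ℝ) (fun y => f j y - g x) x (ℓ j) := fun j hj =>
      ⟨(hℓ j hj).1.sub continuousAt_const, (hℓ j hj).2.sub_const (g x)⟩
    have hD := hasMFDerivAt_sum_mul J hdρ hℓ'
    have hev : (fun y => (∑ᶠ j, ρ j y • f j y) - g x) =ᶠ[𝓝 x]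
        fun y => ∑ j ∈ J, ρ j y * (f j y - g x) := by
      filter_upwards [ρ.eventually_finsupport_subset x] with y hy using hsub x y hy (g x)
    have hD2 := hD.congr_of_eventuallyEq hev
    have hD3 := hD2.2.add_const (g x)
    refine ⟨_, ⟨hsmooth.continuous.continuousAt, hD3.congr_fderiv rfl |>.congr ?_ ?_⟩, ?_⟩
    · intro y _
      exact (sub_add_cancel _ (g x)).symm
    · exact (sub_add_cancel _ (g x)).symm
    · intro v
      have happ : (∑ j ∈ J, (ρ j x • ℓ j + (f j x - g x) • dρ j) : TangentSpace I x →L[ℝ] ℝ) v =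
          ∑ j ∈ J, ρ j x * ℓ j v + ∑ j ∈ J, (f j x - g x) * dρ j v := by
        rw [sum_apply, ← Finset.sum_add_distrib]
        rfl
      rw [happ]
      have h1 : |∑ j ∈ J, ρ j x * ℓ j v| ≤ 4 * ‖v‖ := by
        calc |∑ j ∈ J, ρ j x * ℓ j v| ≤ ∑ j ∈ J, ρ j x * (4 * ‖v‖) := by
              refine (Finset.abs_sum_le_sum_abs _ _).trans (Finset.sum_le_sum fun j hj => ?_)
              rw [abs_mul, abs_of_nonneg (ρ.nonneg j x)]
              exact mul_le_mul_of_nonneg_left (hℓv j hj v) (ρ.nonneg j x)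
          _ = 4 * ‖v‖ := by rw [← Finset.sum_mul, hone x x (hself x), one_mul]
      have h2 : |∑ j ∈ J, (f j x - g x) * dρ j v| ≤ ‖v‖ := by
        set A := ∑ j ∈ J, |dρ j v| with hA
        have hA0 : 0 ≤ A := Finset.sum_nonneg fun _ _ => abs_nonneg _
        -- Each index `j ∈ J` has `x ∈ K j`, so its own constant `c j` bounds the full sum `A`.
        have hb : ∀ j ∈ J, |f j x - g x| * A ≤ ‖v‖ := by
          intro j hj
          have h3 : A ≤ c j * ‖v‖ := hcK j x (hmem j hj).2 v
          have h4 := (hf j x (hmem j hj).1).1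
          have h5 : (0 : ℝ) < c j + 1 := by linarith [hc j]
          calc |f j x - g x| * A ≤ 1 / (c j + 1) * (c j * ‖v‖) := by gcongr
            _ = c j / (c j + 1) * ‖v‖ := by ring
            _ ≤ 1 * ‖v‖ := by
                gcongr
                rw [div_le_one h5]
                linarith
            _ = ‖v‖ := one_mul _
        have h3 : |∑ j ∈ J, (f j x - g x) * dρ j v| ≤ ∑ j ∈ J, |f j x - g x| * |dρ j v| :=
          (Finset.abs_sum_le_sum_abs _ _).trans_eq (Finset.sum_congr rfl fun _ _ => abs_mul _ _)
        refine h3.trans ?_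
        rcases hA0.eq_or_lt with h0 | hpos
        · have h4 := (Finset.sum_eq_zero_iff_of_nonneg fun j _ => abs_nonneg (dρ j v)).1 h0.symm
          rw [Finset.sum_eq_zero fun j hj => by rw [h4 j hj, mul_zero]]
          exact norm_nonneg v
        · calc ∑ j ∈ J, |f j x - g x| * |dρ j v| ≤ ∑ j ∈ J, ‖v‖ / A * |dρ j v| := by
                gcongr with j hj
                rw [le_div_iff₀ hpos]
                exact hb j hj
            _ = ‖v‖ := by rw [← Finset.mul_sum, ← hA, div_mul_cancel₀ _ hpos.ne']
      exact (abs_add_le _ _).trans (by linarith)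

end Gluing

/-! ### The Hopf–Rinow theorem: bounded closed sets are compact -/

section HopfRinow

/-- In a complete locally compact metric space in which every point has almost-intermediate points
towards `p`, all closed balls around `p` are compact. -/
lemma isCompact_closedBall_of_length {X : Type*} [MetricSpace X] [CompleteSpace X]
    [LocallyCompactSpace X] (p : X)
    (h : ∀ x a b, 0 ≤ a → 0 < b → dist p x < a + b → ∃ z, dist p z ≤ a ∧ dist z x < b) (r : ℝ) :
    IsCompact (Metric.closedBall p r) := by
  by_contra hr
  have hr0 : 0 ≤ r := by
    by_contra! hlt
    exact hr (by simp [Metric.closedBall_eq_empty.2 hlt])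
  set S : Set ℝ := {s | IsCompact (Metric.closedBall p s)} with hS
  have hmono : ∀ s ∈ S, ∀ t ≤ s, t ∈ S := fun s hs t hts =>
    IsCompact.of_isClosed_subset hs Metric.isClosed_closedBall (Metric.closedBall_subset_closedBall hts)
  have h0 : (0 : ℝ) ∈ S := by simp [hS]
  have hbdd : BddAbove S := ⟨r, fun s hs => by
    by_contra! hlt
    exact hr (hmono s hs r hlt.le)⟩
  set s := sSup S
  have hs0 : 0 ≤ s := le_csSup hbdd h0
  have hlt : ∀ t < s, t ∈ S := fun t ht => by
    obtain ⟨t', ht', htt'⟩ := exists_lt_of_lt_csSup ⟨0, h0⟩ ht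
    exact hmono t' ht' t htt'.le
  -- The supremum is attained: almost-intermediate points make an `ε / 2`-net of a slightly smaller,
  -- compact ball an `ε`-net of this one.
  have hsS : IsCompact (Metric.closedBall p s) := by
    refine TotallyBounded.isCompact_of_isClosed (Metric.totallyBounded_iff.2 fun ε hε => ?_)
      Metric.isClosed_closedBall
    have ha : max 0 (s - ε / 4) ∈ S := by
      rcases le_total (s - ε / 4) 0 with h1 | h1
      · rwa [max_eq_left h1]
      · rw [max_eq_right h1]
        exact hlt _ (by linarith)
    obtain ⟨t, ht, hcov⟩ := Metric.totallyBounded_iff.1 (IsCompact.totallyBounded ha) (ε / 2)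
      (half_pos hε)
    refine ⟨t, ht, fun x hx => ?_⟩
    obtain ⟨z, hz, hzx⟩ := h x (max 0 (s - ε / 4)) (ε / 2) (le_max_left _ _) (half_pos hε) (by
      rw [Metric.mem_closedBall, dist_comm] at hx
      linarith [le_max_right 0 (s - ε / 4)])
    obtain ⟨y, hy, hzy⟩ := mem_iUnion₂.1 (hcov (by rwa [Metric.mem_closedBall, dist_comm]))
    refine mem_iUnion₂.2 ⟨y, hy, ?_⟩
    rw [Metric.mem_ball] at hzy ⊢
    rw [dist_comm] at hzx
    linarith [dist_triangle x z y]
  -- A compact thickening of the ball contains the ball of radius `s + δ / 2`, against the choice of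
  -- `s`.
  obtain ⟨δ, hδ, hδc⟩ := hsS.exists_isCompact_cthickening
  have hmem : s + δ / 2 ∈ S := by
    refine IsCompact.of_isClosed_subset hδc Metric.isClosed_closedBall fun x hx => ?_
    obtain ⟨z, hz, hzx⟩ := h x s δ hs0 hδ (by
      rw [Metric.mem_closedBall, dist_comm] at hx
      linarith)
    refine Metric.thickening_subset_cthickening _ _ (Metric.mem_thickening_iff.2
      ⟨z, by rwa [Metric.mem_closedBall, dist_comm], by rwa [dist_comm]⟩)
  linarith [le_csSup hbdd hmem]

variable {n : ℕ} {H : Type*} [TopologicalSpace H]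
  (I : ModelWithCorners ℝ (EuclideanSpace ℝ (Fin n)) H)
  {M : Type*} [MetricSpace M] [ChartedSpace H M]
  [RiemannianBundle (fun x : M => TangentSpace I x)] [IsRiemannianManifold I M]

include I in
-- No minimizing geodesic is needed. A path from `p` to `x` of length below `a + b` passes through a
-- point at distance exactly `a` from `p`; its initial piece has length at least `a`, so less than
-- `b` remains.
lemma exists_dist_le_dist_lt {p x : M} {a b : ℝ} (ha : 0 ≤ a) (hb : 0 < b)
    (h : dist p x < a + b) : ∃ z, dist p z ≤ a ∧ dist z x < b := by
  rcases le_or_gt (dist p x) a with hle | hgt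
  · exact ⟨x, hle, by simpa using hb⟩
  have hr : riemannianEDist I p x < (a + b).toNNReal := by
    rw [← IsRiemannianManifold.out (I := I), edist_dist]
    exact (ENNReal.ofReal_lt_ofReal_iff (by linarith)).2 h
  obtain ⟨γ, hγ0, hγ1, hγ, hlen⟩ := exists_lt_of_riemannianEDist_lt hr
  have hcont : ContinuousOn (fun t => dist p (γ t)) (Icc 0 1) :=
    (continuous_const.dist continuous_id).comp_continuousOn hγ.continuousOn
  obtain ⟨t, ht, hta⟩ := intermediate_value_Icc zero_le_one hcont
    (show a ∈ Icc (dist p (γ 0)) (dist p (γ 1)) by simp [hγ0, hγ1, ha, hgt.le])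
  refine ⟨γ t, hta.le, ?_⟩
  have h1 : edist p (γ t) ≤ pathELength I γ 0 t := by
    rw [IsRiemannianManifold.out (I := I)]
    exact riemannianEDist_le_pathELength (hγ.mono (Icc_subset_Icc_right ht.2)) hγ0 rfl ht.1
  have h2 : edist (γ t) x ≤ pathELength I γ t 1 := by
    rw [IsRiemannianManifold.out (I := I)]
    exact riemannianEDist_le_pathELength (hγ.mono (Icc_subset_Icc_left ht.1)) rfl hγ1 ht.2
  have h3 : edist p (γ t) + edist (γ t) x < ENNReal.ofReal (a + b) :=
    (add_le_add h1 h2).trans_lt (by rwa [pathELength_add ht.1 ht.2])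
  rw [edist_dist, edist_dist, ← ENNReal.ofReal_add dist_nonneg dist_nonneg,
    ENNReal.ofReal_lt_ofReal_iff (by linarith)] at h3
  simp only at hta
  linarith

include I in
/-- Closed balls in a complete Riemannian manifold are compact. -/
theorem isCompact_closedBall_of_isRiemannianManifold [CompleteSpace M] (p : M) (r : ℝ) :
    IsCompact (Metric.closedBall p r) := by
  have : LocallyCompactSpace H := I.locallyCompactSpace
  have : LocallyCompactSpace M := ChartedSpace.locallyCompactSpace H M
  exact isCompact_closedBall_of_length p (fun x a b ha hb h => exists_dist_le_dist_lt I ha hb h) r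

end HopfRinow

/-! ### Cutoff functions from a divergent integral -/

/-- As `1 / C` is only continuous, it is replaced by a smooth `a` strictly between `1 / (2 C)` and
`1 / C`. The upper bound controls the derivative of the primitive `h`, the lower bound keeps the
integral divergent. -/
lemma exists_contDiff_monotone_tendsto_atTop {C : ℝ → ℝ} (hcont : ContinuousOn C (Ici 0))
    (hpos : ∀ r, 0 ≤ r → 0 < C r)
    (hint : ∫⁻ r in Ioi (0 : ℝ), ENNReal.ofReal (1 / C r) = ⊤) :
    ∃ h : ℝ → ℝ, ContDiff ℝ ∞ h ∧ Monotone h ∧ Filter.Tendsto h Filter.atTop Filter.atTop ∧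
      ∀ r, 0 ≤ r → |deriv h r| ≤ 1 / C r := by
  have hCc : Continuous fun r : ℝ => C (max r 0) :=
    hcont.comp_continuous (by fun_prop) fun r => le_max_right r 0
  set β : ℝ → ℝ := fun r => 1 / C (max r 0) with hβ
  have hβc : Continuous β := continuous_const.div hCc fun r => (hpos _ (le_max_right r 0)).ne'
  have hβpos : ∀ r, 0 < β r := fun r => one_div_pos.2 (hpos _ (le_max_right r 0))
  -- Near each `r` the constant `3 / 4 * β r` is admissible, and the constraint is convex, so the
  -- local choices can be glued.
  obtain ⟨a, ha⟩ := exists_contMDiffMap_forall_mem_convex_of_local_const (n := (⊤ : ℕ∞))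
    𝓘(ℝ, ℝ) (t := fun r : ℝ => Ioo (β r / 2) (β r)) (fun r => convex_Ioo _ _) fun r =>
    ⟨3 / 4 * β r, by
      have h0 := hβpos r
      filter_upwards [(hβc.div_const 2).continuousAt.eventually_lt continuousAt_const
          (show β r / 2 < 3 / 4 * β r by linarith),
        continuousAt_const.eventually_lt hβc.continuousAt
          (show 3 / 4 * β r < β r by linarith)] with y h1 h2 using ⟨h1, h2⟩⟩
  have has : ContDiff ℝ ∞ a := contMDiff_iff_contDiff.1 a.contMDiff
  have hac : Continuous a := has.continuous
  have hapos : ∀ r, 0 < a r := fun r => (half_pos (hβpos r)).trans (ha r).1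
  have hder : ∀ r, HasDerivAt (fun r => ∫ t in (0 : ℝ)..r, a t) (a r) r := fun r =>
    intervalIntegral.integral_hasDerivAt_right (hac.intervalIntegrable _ _)
      hac.stronglyMeasurable.stronglyMeasurableAtFilter hac.continuousAt
  have hderiv : deriv (fun r => ∫ t in (0 : ℝ)..r, a t) = a := funext fun r => (hder r).deriv
  have hmono : Monotone fun r => ∫ t in (0 : ℝ)..r, a t :=
    monotone_of_deriv_nonneg (fun r => (hder r).differentiableAt) fun r => by
      rw [hderiv]
      exact (hapos r).le
  refine ⟨fun r => ∫ t in (0 : ℝ)..r, a t, ?_, hmono, ?_, fun r hr => ?_⟩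
  · rw [contDiff_infty_iff_deriv, hderiv]
    exact ⟨fun r => (hder r).differentiableAt, has⟩
  · by_contra hnot
    have hbdd : ∃ b, ∀ r, ∫ t in (0 : ℝ)..r, a t < b := by
      by_contra! hb
      exact hnot (Filter.tendsto_atTop_atTop_of_monotone hmono hb)
    obtain ⟨b, hb⟩ := hbdd
    have hai : IntegrableOn a (Ioi 0) :=
      integrableOn_Ioi_of_intervalIntegral_norm_bounded b 0 (l := Filter.atTop) (b := id)
        (fun r => (hac.integrableOn_Icc).mono_set Ioc_subset_Icc_self) Filter.tendsto_id
        (Filter.Eventually.of_forall fun r => by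
          simpa only [id, Real.norm_of_nonneg (hapos _).le] using (hb r).le)
    have hfin : ∫⁻ r in Ioi (0 : ℝ), ENNReal.ofReal (2 * a r) < ⊤ :=
      ((hasFiniteIntegral_iff_ofReal (Filter.Eventually.of_forall fun r =>
        mul_nonneg zero_le_two (hapos r).le)).1 (hai.const_mul 2).2)
    refine (lt_irrefl (⊤ : ℝ≥0∞)) (lt_of_le_of_lt ?_ hfin)
    rw [← hint]
    refine setLIntegral_mono_ae' measurableSet_Ioi (Filter.Eventually.of_forall fun r hr => ?_)
    refine ENNReal.ofReal_le_ofReal ?_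
    have h1 := (ha r).1
    simp only [hβ, max_eq_left (le_of_lt (mem_Ioi.1 hr))] at h1
    linarith
  · rw [hderiv, abs_of_pos (hapos r)]
    have h1 := (ha r).2
    simp only [hβ, max_eq_left hr] at h1
    exact h1.le

lemma exists_contDiff_step : ∃ (θ : ℝ → ℝ) (B : ℝ), ContDiff ℝ ∞ θ ∧ (∀ t, θ t ∈ Icc (0 : ℝ) 1) ∧
    (∀ t ≤ 1, θ t = 1) ∧ (∀ t, 2 ≤ t → θ t = 0) ∧ ∀ t, |deriv θ t| ≤ B := by
  set θ : ℝ → ℝ := fun t => Real.smoothTransition (2 - t) with hθ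
  have hsm : ContDiff ℝ ∞ θ := Real.smoothTransition.contDiff.comp (contDiff_const.sub contDiff_id)
  have h1 : ∀ t ≤ 1, θ t = 1 := fun t ht => Real.smoothTransition.one_of_one_le (by linarith)
  have h2 : ∀ t, 2 ≤ t → θ t = 0 := fun t ht => Real.smoothTransition.zero_of_nonpos (by linarith)
  have hsupp : HasCompactSupport (deriv θ) := by
    refine HasCompactSupport.intro (isCompact_Icc (a := (1 : ℝ)) (b := 2)) fun t ht => ?_
    rcases lt_or_ge t 1 with h | h
    · have : θ =ᶠ[𝓝 t] fun _ => 1 := by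
        filter_upwards [Iio_mem_nhds h] with s hs using h1 s (le_of_lt hs)
      rw [this.deriv_eq, deriv_const]
    · have h' : 2 < t := not_le.1 fun h3 => ht ⟨h, h3⟩
      have : θ =ᶠ[𝓝 t] fun _ => 0 := by
        filter_upwards [Ioi_mem_nhds h'] with s hs using h2 s (le_of_lt hs)
      rw [this.deriv_eq, deriv_const]
  obtain ⟨B, hB⟩ := hsupp.exists_bound_of_continuous (hsm.continuous_deriv (by simp))
  exact ⟨θ, B, hsm, fun t => ⟨Real.smoothTransition.nonneg _, Real.smoothTransition.le_one _⟩,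
    h1, h2, hB⟩

/-! ### Cutoff functions on a complete Riemannian manifold -/

section Cutoffs

variable {n : ℕ} {H : Type*} [TopologicalSpace H]
  {I : ModelWithCorners ℝ (EuclideanSpace ℝ (Fin n)) H}
  {M : Type*} [MetricSpace M] [ChartedSpace H M] [IsManifold I ∞ M]
  [SecondCountableTopology M]
  [RiemannianBundle (fun x : M => TangentSpace I x)]
  [IsContMDiffRiemannianBundle I ∞ (EuclideanSpace ℝ (Fin n)) (fun x : M => TangentSpace I x)]
  [IsRiemannianManifold I M] [CompleteSpace M] [MeasurableSpace M] [BorelSpace M]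

/-- On a complete Riemannian manifold there are cutoff functions whose differentials decay
uniformly relative to `1 / C(dist(·, p))`, if `1 / C` is not integrable. -/
theorem exists_isCutoffSequence (p : M) {C : ℝ → ℝ} (hC_cont : ContinuousOn C (Ici 0))
    (hC_mono : MonotoneOn C (Ici 0)) (hC_pos : ∀ r, 0 ≤ r → 0 < C r)
    (hC_int : ∫⁻ r in Ioi (0 : ℝ), ENNReal.ofReal (1 / C r) = ⊤) :
    ∃ (χ : ℕ → C^∞⟮I, M; ℝ⟯) (S : ℕ → Set M) (B : ℝ), 0 ≤ B ∧ IsCutoffSequence χ S ∧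
      ∀ k x, ∃ ℓ : TangentSpace I x →L[ℝ] ℝ, mfderiv I 𝓘(ℝ, ℝ) (χ k) x = ℓ ∧
        C (dist x p) * ‖ℓ‖ ≤ B / (k + 1) := by
  obtain ⟨f₀, hf₀, hf₀'⟩ := exists_smooth_approx_of_lipschitzWith (I := I)
    (LipschitzWith.dist_left p)
  obtain ⟨h, hh, hmono, htop, hderiv⟩ := exists_contDiff_monotone_tendsto_atTop hC_cont hC_pos hC_int
  obtain ⟨θ, B, hθ, hθ01, hθ1, hθ0, hB⟩ := exists_contDiff_step
  have hB0 : 0 ≤ B := (abs_nonneg _).trans (hB 0)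
  -- The shift by `1` ensures `f₀ x + 1 ≥ dist x p ≥ 0`, so that `h` is evaluated where its
  -- derivative is controlled and `C` can be compared by monotonicity.
  let ψ : ℕ → ℝ → ℝ := fun k r => θ (h (r + 1) / (k + 1))
  have hk : ∀ k : ℕ, (0 : ℝ) < k + 1 := fun k => by positivity
  have hψ : ∀ k, ContDiff ℝ ∞ (ψ k) := fun k =>
    hθ.comp ((hh.comp (contDiff_id.add contDiff_const)).div_const _)
  have hle : ∀ x, dist x p ≤ f₀ x + 1 := fun x => by
    have := (abs_le.1 (hf₀ x)).1
    linarith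
  have hf₀c : Continuous f₀ := f₀.contMDiff.continuous
  let χ : ℕ → C^∞⟮I, M; ℝ⟯ := fun k => ⟨fun x => ψ k (f₀ x), (hψ k).contMDiff.comp f₀.contMDiff⟩
  -- Off this set the argument of `θ` is at most `1`. The factor `5` is the bound on the
  -- differential of `f₀`.
  refine ⟨χ, fun k => {x | (k + 1 : ℝ) < h (f₀ x + 1)}, B * 5, by positivity, ?_, fun k x => ?_⟩
  · refine ⟨fun k x => hθ01 _, fun k => ?_, fun k => ?_, fun k l hkl x hx => ?_, ?_,
      fun k x hx => hθ1 _ ?_⟩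
    -- Off a large ball, compact by Hopf–Rinow, the argument of `θ` is at least `2`.
    · obtain ⟨R, hR⟩ := Filter.tendsto_atTop_atTop.1 htop (2 * (k + 1))
      refine ⟨_, isCompact_closedBall_of_isRiemannianManifold I p (R + 1), fun x hx => hθ0 _ ?_⟩
      rw [Metric.mem_closedBall, not_le] at hx
      rw [le_div_iff₀ (hk k)]
      exact hR _ (by linarith [hle x])
    · exact (isOpen_lt continuous_const
        (hh.continuous.comp (hf₀c.add continuous_const))).measurableSet
    · have : (k : ℝ) ≤ l := by exact_mod_cast hkl
      exact lt_of_le_of_lt (by linarith) (mem_ofPred.1 hx)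
    · refine eq_empty_iff_forall_notMem.2 fun x hx => ?_
      obtain ⟨k, hk'⟩ := exists_nat_gt (h (f₀ x + 1))
      have := mem_iInter.1 hx k
      rw [mem_ofPred] at this
      linarith
    · rw [div_le_one (hk k)]
      exact not_lt.1 hx
  · obtain ⟨ℓ, hℓ, hℓv⟩ := hf₀' x
    have hx0 : 0 ≤ f₀ x + 1 := dist_nonneg.trans (hle x)
    have hCd := hC_pos _ (dist_nonneg (x := x) (y := p))
    have hψd : HasDerivAt (ψ k) (deriv θ (h (f₀ x + 1) / (k + 1)) *
        (deriv h (f₀ x + 1) / (k + 1))) (f₀ x) := by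
      have h1 : HasDerivAt (fun r : ℝ => h (r + 1)) (deriv h (f₀ x + 1)) (f₀ x) :=
        ((hh.differentiable (by simp)) (f₀ x + 1)).hasDerivAt.comp_add_const (f₀ x) 1
      exact (((hθ.differentiable (by simp)) _).hasDerivAt).comp (f₀ x) (h1.div_const _)
    set c := deriv θ (h (f₀ x + 1) / (k + 1)) * (deriv h (f₀ x + 1) / (k + 1)) with hc
    have hχd : (mfderiv I 𝓘(ℝ, ℝ) (χ k) x : TangentSpace I x →L[ℝ] ℝ) = c • ℓ := by
      refine (hψd.hasFDerivAt.hasMFDerivAt.comp x hℓ).mfderiv.trans ?_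
      exact ContinuousLinearMap.ext fun v => mul_comm (ℓ v) c
    refine ⟨c • ℓ, hχd, ?_⟩
    rw [mul_comm, ← le_div_iff₀ hCd]
    refine ContinuousLinearMap.opNorm_le_bound _ (by positivity) fun v => ?_
    -- Monotonicity of `C` enters here, through `dist x p ≤ f₀ x + 1`.
    have hd : |deriv h (f₀ x + 1)| ≤ 1 / C (dist x p) :=
      (hderiv _ hx0).trans (one_div_le_one_div_of_le hCd (hC_mono dist_nonneg hx0 (hle x)))
    rw [smul_apply, norm_smul, mul_comm, hc, norm_mul, norm_div,
      Real.norm_of_nonneg (hk k).le]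
    calc _ ≤ (5 * ‖v‖) * (B * (1 / C (dist x p) / (k + 1))) := by
          gcongr
          · exact hℓv v
          · exact hB _
          · exact hd
      _ = _ := by ring

end Cutoffs

end FirstOrderCompleteness

end

/-! ### The main theorem -/

open FirstOrderCompleteness in
theorem theorem2p1
    -- a connected smooth manifold (possibly with boundary)
    {n : ℕ} {H : Type*} [TopologicalSpace H]
    (I : ModelWithCorners ℝ (EuclideanSpace ℝ (Fin n)) H)
    {M : Type*} [MetricSpace M] [ChartedSpace H M] [IsManifold I ∞ M]
    [SecondCountableTopology M]
    -- a complete Riemannian metric, whose distance function is `dist`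
    [RiemannianBundle (fun x : M => TangentSpace I x)]
    [IsContMDiffRiemannianBundle I ∞ (EuclideanSpace ℝ (Fin n)) (fun x : M => TangentSpace I x)]
    [IsRiemannianManifold I M] [CompleteSpace M]
    -- a smooth measure
    [MeasurableSpace M] [BorelSpace M] (μ : Measure M) (hμ : IsSmoothMeasure I μ)
    -- the Hermitian vector bundles `E` and `F`
    {E₀ : Type*} [NormedAddCommGroup E₀] [NormedSpace ℂ E₀] [FiniteDimensional ℂ E₀]
    {E : M → Type*} [TopologicalSpace (TotalSpace E₀ E)]
    [∀ x, NormedAddCommGroup (E x)] [∀ x, InnerProductSpace ℂ (E x)]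
    [FiberBundle E₀ E] [VectorBundle ℂ E₀ E] [VectorBundle ℝ E₀ E]
    [ContMDiffVectorBundle ∞ E₀ E I] (hE : IsSmoothHermitian I E₀ E)
    {F₀ : Type*} [NormedAddCommGroup F₀] [NormedSpace ℂ F₀] [FiniteDimensional ℂ F₀]
    {F : M → Type*} [TopologicalSpace (TotalSpace F₀ F)]
    [∀ x, NormedAddCommGroup (F x)] [∀ x, InnerProductSpace ℂ (F x)]
    [FiberBundle F₀ F] [VectorBundle ℂ F₀ F] [VectorBundle ℝ F₀ F]
    [ContMDiffVectorBundle ∞ F₀ F I] (hF : IsSmoothHermitian I F₀ F)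
    -- the first-order differential operator `D` and its formal adjoint `D†`
    (D : SmoothSections I E₀ E →ₗ[ℂ] SmoothSections I F₀ F) (hD : IsFirstOrder D)
    (Ddag : SmoothSections I F₀ F →ₗ[ℂ] SmoothSections I E₀ E) (hDdag : IsFormalAdjoint μ D Ddag)
    -- the bound on the principal symbol
    (p : M) (C : ℝ → ℝ) (hC_cont : ContinuousOn C (Set.Ici 0)) (hC_mono : MonotoneOn C (Set.Ici 0))
    (hC_pos : ∀ r, 0 ≤ r → 0 < C r)
    (hC_int : ∫⁻ r in Set.Ioi (0 : ℝ), ENNReal.ofReal (1 / C r) = ⊤)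
    (hsymb : ∀ (x : M) (ξ : TangentSpace I x →L[ℝ] ℝ) (e : E x),
      ‖principalSymbol D x ξ e‖ ≤ C (dist x p) * ‖ξ‖ * ‖e‖) :
    -- `D_max = (D†)*` and `(D†)_max = D*` are complete
    IsComplete μ (maxGraph μ Ddag) ∧ IsComplete μ (maxGraph μ D) := by
  obtain ⟨χ, S, B, hB, hχ, hbound⟩ :=
    exists_isCutoffSequence (I := I) p hC_cont hC_mono hC_pos hC_int
  refine isComplete_of_isCutoffSequence (c := fun k : ℕ => B / (k + 1)) hμ hE hF hD hDdag hχ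
    (fun k => by positivity) (fun k x e => ?_)
    (tendsto_const_nhds.div_atTop
      (Filter.tendsto_atTop_add_const_right _ 1 tendsto_natCast_atTop_atTop))
  -- The growth `C (dist x p)` of the symbol is absorbed by the decay of `dχ_k`, leaving `B / (k +
  -- 1)`.
  obtain ⟨ℓ, hℓ, hbd⟩ := hbound k x
  rw [hℓ]
  exact (hsymb x ℓ e).trans (mul_le_mul_of_nonneg_right hbd (norm_nonneg e))
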